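/- Let $G=(V,E)$ be a finite directed graph with $n\ge 1$ vertices and $m$ edges. For a directed graph $H$, an edge $(u,w)$ of $H$ is said to be *between* strongly connected components (SCCs) of $H$ if $u$ and $w$ lie in different SCCs of $H$. $H\setminus\{v\}$ denotes $H$ with the vertex $v$ and its incident edges removed, and $U(H)$ denotes the undirected graph obtained from $H$ by forgetting the directions of the edges. The $2$-connected components of an undirected graph are its maximal $2$-vertex-connected subgraphs; here an undirected graph is $2$-vertex-connected if it has at least three vertices and remains connected after the deletion of any set of at most one vertex. Consider the following algorithm (Erusalimskii and Svetlov, 1980) for computing the $2$-vertex-connected components of $G$. 1. Repeat the following until no edge was removed during step (b): (a) compute the SCCs of $G$ and remove from $G$ the edges between them; (b) for every vertex $v\in V$ in turn, compute the SCCs of $G\setminus\{v\}$ and remove from $G$ the edges between them. 2. Let $G'$ be the resulting directed graph. Compute and output (the vertex sets of) the $2$-connected components of $U(G')$. Given $G$ as a list of its edges, and with suitable correct subroutines for computing SCCs and $2$-connected components, this algorithm can be carried out on a unit-cost random access machine, whose only arithmetic operations are successor and predecessor, in $O\big((m+1)\,n\,(n+m)\big)$ steps. In particular its running time is $O(nm^2)$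 on directed graphs with $n=O(m)$: for every $K$ there is a constant $C$ such that at most $C\,n\,m^2$ steps are taken on every directed graph with $n\ge1$ and $n\le K m$. -/

import Mathlib

namespace ErSv

/-! ### Graphs -/

/-- `G ∖ U`: the directed graph obtained from `G` by removing the vertices in `U` and their
incident edges. -/
def deleteVerts {V : Type*} (G : Digraph V) (U : Set V) : Digraph {v : V // v ∉ U} where
  Adj a b := G.Adj a.1 b.1

/-- `u` and `w` lie in the same strongly connected component of `G`. -/
def SameSCC {V : Type*} (G : Digraph V) (u w : V) : Prop :=
  Relation.ReflTransGen G.Adj u w ∧ Relation.ReflTransGen G.Adj w u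

/-- The subgraph of the undirected graph `H` induced on `C` is `k`-vertex-connected: it has at
least `k + 1` vertices and stays connected after the deletion of any set of fewer than `k`
vertices. -/
def IsVertexConnectedOn {V : Type*} (H : SimpleGraph V) (k : ℕ) (C : Set V) : Prop :=
  k + 1 ≤ C.ncard ∧ ∀ X : Set V, X ⊆ C → X.ncard < k → (H.induce (C \ X)).Connected

/-- The vertex sets of the 2-connected components of the undirected graph `H`, that is, of its
maximal 2-vertex-connected subgraphs. -/
def twoConnectedComponents {V : Type*} (H : SimpleGraph V) : Set (Set V) :=
  {C | Maximal (IsVertexConnectedOn H 2) C}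

/-- `es` lists every edge of `G` exactly once; in particular its length is the number of edges. -/
def IsEdgeList {V : Type*} (G : Digraph V) (es : List (V × V)) : Prop :=
  es.Nodup ∧ ∀ u w : V, (u, w) ∈ es ↔ G.Adj u w

/-! ### A random access machine

The memory consists of registers and of arrays indexed by natural numbers, all holding natural
numbers. The only arithmetic operations are successor and predecessor, so that charging one unit
for each of them is fair: a number in memory never exceeds the largest input number or program
constant plus the number of steps carried out. -/

/-- Registers. -/
inductive Reg : Type
  /-- number of vertices -/
  | n
  /-- number of entries of the edge list -/
  | m
  /-- the vertex that is deleted in the current call of the subroutine for strong components -/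
  | x
  /-- loop variable running over the edges -/
  | e
  /-- flag: has an edge been removed? -/
  | changed
  /-- number of output components -/
  | count
  /-- scratch registers for the subroutines -/
  | tmp (i : ℕ)
  deriving DecidableEq

/-- Arrays. -/
inductive Arr : Type
  /-- tails of the edges -/
  | src
  /-- heads of the edges -/
  | dst
  /-- `alive e ≠ 0` if the edge number `e` has not been removed -/
  | alive
  /-- labels of the strongly connected components -/
  | comp
  /-- output: where the components start in `outVert` -/
  | outStart
  /-- output: the vertices of the components, one component after the other -/
  | outVert
  /-- scratch arrays for the subroutines -/
  | tmp (i : ℕ)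
  deriving DecidableEq

/-- Memory contents. -/
structure State where
  reg : Reg → ℕ
  arr : Arr → ℕ → ℕ

/-- Expressions. -/
inductive Expr : Type
  | const (c : ℕ)
  | reg (r : Reg)
  | get (a : Arr) (i : Expr)
  | succ (t : Expr)
  | pred (t : Expr)

/-- Tests. -/
inductive Test : Type
  | eq (s t : Expr)
  | lt (s t : Expr)
  | not (b : Test)
  | and (b c : Test)

/-- Programs. -/
inductive Cmd : Type
  | skip
  | assign (r : Reg) (t : Expr)
  | store (a : Arr) (i t : Expr)
  | seq (c d : Cmd)
  | cond (b : Test) (c d : Cmd)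
  | while (b : Test) (c : Cmd)

namespace Expr

/-- The value of an expression. -/
def eval (σ : State) : Expr → ℕ
  | const c => c
  | reg r => σ.reg r
  | get a i => σ.arr a (i.eval σ)
  | succ t => t.eval σ + 1
  | pred t => t.eval σ - 1

/-- The number of steps needed to evaluate an expression: one for each operation in it. -/
def cost : Expr → ℕ
  | const _ => 1
  | reg _ => 1
  | get _ i => i.cost + 1
  | succ t => t.cost + 1
  | pred t => t.cost + 1

end Expr

namespace Test

/-- The truth value of a test. -/
def eval (σ : State) : Test → Bool
  | eq s t => decide (s.eval σ = t.eval σ)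
  | lt s t => decide (s.eval σ < t.eval σ)
  | not b => !(b.eval σ)
  | and b c => b.eval σ && c.eval σ

/-- The number of steps needed to evaluate a test. -/
def cost : Test → ℕ
  | eq s t => s.cost + t.cost + 1
  | lt s t => s.cost + t.cost + 1
  | not b => b.cost + 1
  | and b c => b.cost + c.cost + 1

end Test

/-- The memory after writing `k` to the register `r`. -/
def State.setReg (σ : State) (r : Reg) (k : ℕ) : State :=
  { σ with reg := Function.update σ.reg r k }

/-- The memory after writing `k` to the cell `i` of the array `a`. -/
def State.setArr (σ : State) (a : Arr) (i k : ℕ) : State :=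
  { σ with arr := Function.update σ.arr a (Function.update (σ.arr a) i k) }

/-- `Exec c σ σ' t`: started in memory `σ`, the program `c` halts in memory `σ'` after `t`
steps. -/
inductive Exec : Cmd → State → State → ℕ → Prop
  | skip (σ : State) : Exec Cmd.skip σ σ 1
  | assign (σ : State) (r : Reg) (t : Expr) :
      Exec (Cmd.assign r t) σ (σ.setReg r (t.eval σ)) (t.cost + 1)
  | store (σ : State) (a : Arr) (i t : Expr) :
      Exec (Cmd.store a i t) σ (σ.setArr a (i.eval σ) (t.eval σ)) (i.cost + t.cost + 1)
  | seq {c d : Cmd} {σ σ₁ σ₂ : State} {t₁ t₂ : ℕ} :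
      Exec c σ σ₁ t₁ → Exec d σ₁ σ₂ t₂ → Exec (Cmd.seq c d) σ σ₂ (t₁ + t₂)
  | cond_true {b : Test} {c d : Cmd} {σ σ₁ : State} {t : ℕ} :
      b.eval σ = true → Exec c σ σ₁ t → Exec (Cmd.cond b c d) σ σ₁ (b.cost + t)
  | cond_false {b : Test} {c d : Cmd} {σ σ₁ : State} {t : ℕ} :
      b.eval σ = false → Exec d σ σ₁ t → Exec (Cmd.cond b c d) σ σ₁ (b.cost + t)
  | while_false {b : Test} {c : Cmd} {σ : State} :
      b.eval σ = false → Exec (Cmd.while b c) σ σ b.cost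
  | while_true {b : Test} {c : Cmd} {σ σ₁ σ₂ : State} {t₁ t₂ : ℕ} :
      b.eval σ = true → Exec c σ σ₁ t₁ → Exec (Cmd.while b c) σ₁ σ₂ t₂ →
      Exec (Cmd.while b c) σ σ₂ (b.cost + t₁ + t₂)

/-- The machine is deterministic: final memory and running time are unique. -/
theorem Exec.det {c : Cmd} {σ σ₁ σ₂ : State} {t₁ t₂ : ℕ}
    (h₁ : Exec c σ σ₁ t₁) (h₂ : Exec c σ σ₂ t₂) : σ₁ = σ₂ ∧ t₁ = t₂ := by
  induction h₁ generalizing σ₂ t₂ with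
  | skip | assign | store => cases h₂; exact ⟨rfl, rfl⟩
  | seq _ _ ih₁ ih₂ =>
    cases h₂ with
    | seq k₁ k₂ =>
      obtain ⟨rfl, rfl⟩ := ih₁ k₁
      obtain ⟨rfl, rfl⟩ := ih₂ k₂
      exact ⟨rfl, rfl⟩
  | cond_true hb _ ih =>
    cases h₂ with
    | cond_true _ k =>
      obtain ⟨rfl, rfl⟩ := ih k
      exact ⟨rfl, rfl⟩
    | cond_false hb' _ => simp [hb] at hb'
  | cond_false hb _ ih =>
    cases h₂ with
    | cond_true hb' _ => simp [hb] at hb'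
    | cond_false _ k =>
      obtain ⟨rfl, rfl⟩ := ih k
      exact ⟨rfl, rfl⟩
  | while_false hb =>
    cases h₂ with
    | while_false _ => exact ⟨rfl, rfl⟩
    | while_true hb' _ _ => simp [hb] at hb'
  | while_true hb _ _ ih₁ ih₂ =>
    cases h₂ with
    | while_false hb' => simp [hb] at hb'
    | while_true _ k₁ k₂ =>
      obtain ⟨rfl, rfl⟩ := ih₁ k₁
      obtain ⟨rfl, rfl⟩ := ih₂ k₂
      exact ⟨rfl, rfl⟩

infixr:60 " ;; " => Cmd.seq

/-- `repeat c until b`. -/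
def repeatUntil (c : Cmd) (b : Test) : Cmd :=
  c ;; Cmd.while (Test.not b) c

/-- `for r := 0, 1, …, b - 1 do c`, where `b` is the content of the register `bound`. -/
def forLoop (r bound : Reg) (c : Cmd) : Cmd :=
  Cmd.assign r (Expr.const 0) ;;
  Cmd.while (Test.lt (Expr.reg r) (Expr.reg bound))
    (c ;; Cmd.assign r (Expr.succ (Expr.reg r)))

/-! ### The algorithm -/

/-- The tail of the current edge. -/
def curSrc : Expr := Expr.get Arr.src (Expr.reg Reg.e)

/-- The head of the current edge. -/
def curDst : Expr := Expr.get Arr.dst (Expr.reg Reg.e)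

/-- The current edge is an edge of `G ∖ {x}` whose ends carry different component labels. -/
def isBetween : Test :=
  Test.and (Test.not (Test.eq (Expr.get Arr.alive (Expr.reg Reg.e)) (Expr.const 0)))
    (Test.and (Test.not (Test.eq curSrc (Expr.reg Reg.x)))
      (Test.and (Test.not (Test.eq curDst (Expr.reg Reg.x)))
        (Test.not (Test.eq (Expr.get Arr.comp curSrc) (Expr.get Arr.comp curDst)))))

/-- Remove from `G` the edges between the labelled components of `G ∖ {x}`, and set the flag if
there is such an edge. -/
def removeBetween : Cmd :=
  forLoop Reg.e Reg.m
    (Cmd.cond isBetween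
      (Cmd.store Arr.alive (Expr.reg Reg.e) (Expr.const 0) ;;
        Cmd.assign Reg.changed (Expr.const 1))
      Cmd.skip)

/-- One iteration of the main loop. As the vertices are `0, …, n - 1`, no vertex is deleted from
`G` when `x = n`. -/
def iteration (scc : Cmd) : Cmd :=
  Cmd.assign Reg.x (Expr.reg Reg.n) ;;
  scc ;;
  removeBetween ;;
  Cmd.assign Reg.changed (Expr.const 0) ;;
  forLoop Reg.x Reg.n (scc ;; removeBetween)

/-- The algorithm of Erusalimskii and Svetlov, with the subroutine `scc` for computing strongly
connected components and the subroutine `bcc` for computing 2-connected components. First all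
edges of the input are marked as present. -/
def erusalimskiiSvetlov (scc bcc : Cmd) : Cmd :=
  forLoop Reg.e Reg.m (Cmd.store Arr.alive (Expr.reg Reg.e) (Expr.const 1)) ;;
  repeatUntil (iteration scc) (Test.eq (Expr.reg Reg.changed) (Expr.const 0)) ;;
  bcc

/-! ### What the subroutines have to do -/

/-- The current directed graph on `n` vertices stored in the memory. -/
def State.graph (σ : State) (n : ℕ) : Digraph (Fin n) where
  Adj u w := ∃ e < σ.reg Reg.m,
    σ.arr Arr.alive e ≠ 0 ∧ σ.arr Arr.src e = u ∧ σ.arr Arr.dst e = w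

/-- The memory holds a directed graph on the vertices `0, …, n - 1`. -/
def State.Valid (σ : State) (n : ℕ) : Prop :=
  σ.reg Reg.n = n ∧ ∀ e < σ.reg Reg.m, σ.arr Arr.src e < n ∧ σ.arr Arr.dst e < n

/-- `σ` and `σ'` agree on the stored graph. -/
def SameGraph (σ σ' : State) : Prop :=
  σ'.reg Reg.n = σ.reg Reg.n ∧ σ'.reg Reg.m = σ.reg Reg.m ∧
  σ'.arr Arr.src = σ.arr Arr.src ∧ σ'.arr Arr.dst = σ.arr Arr.dst ∧
  σ'.arr Arr.alive = σ.arr Arr.alive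

/-- `scc` computes the strongly connected components of `G ∖ {x}`: whatever the memory holds
elsewhere, it halts, leaves the graph and the variables of the main program alone, and labels the
vertices of `G ∖ {x}` so that two of them get the same label exactly if they lie in the same
strongly connected component of `G ∖ {x}`. (If `x` is not a vertex then `G ∖ {x} = G`.) -/
def ComputesSCC (scc : Cmd) : Prop :=
  ∀ (n : ℕ) (σ : State), σ.Valid n → ∃ (σ' : State) (t : ℕ), Exec scc σ σ' t ∧
    SameGraph σ σ' ∧ σ'.reg Reg.x = σ.reg Reg.x ∧ σ'.reg Reg.changed = σ.reg Reg.changed ∧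
    ∀ u w : {v : Fin n // v ∉ {v : Fin n | (v : ℕ) = σ.reg Reg.x}},
      σ'.arr Arr.comp u.1 = σ'.arr Arr.comp w.1 ↔ SameSCC (deleteVerts (σ.graph n) _) u w

/-- The set of vertices in the output component number `i`. -/
def State.outputSet (σ : State) (n i : ℕ) : Set (Fin n) :=
  {v | ∃ j, σ.arr Arr.outStart i ≤ j ∧ j < σ.arr Arr.outStart (i + 1) ∧
    σ.arr Arr.outVert j = v}

/-- The output in memory `σ` lists each member of the family `F` of vertex sets exactly once, each
of them by listing each of its vertices exactly once. -/
def State.Outputs (σ : State) (n : ℕ) (F : Set (Set (Fin n))) : Prop :=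
  Set.BijOn (σ.outputSet n) (Set.Iio (σ.reg Reg.count)) F ∧
  ∀ i < σ.reg Reg.count,
    (∀ j, σ.arr Arr.outStart i ≤ j → j < σ.arr Arr.outStart (i + 1) → σ.arr Arr.outVert j < n) ∧
    Set.InjOn (σ.arr Arr.outVert)
      (Set.Ico (σ.arr Arr.outStart i) (σ.arr Arr.outStart (i + 1)))

/-- `bcc` computes the 2-connected components of the undirected version of the stored graph:
whatever the memory holds elsewhere, it halts, leaves the graph alone and outputs them. -/
def ComputesTwoConnectedComponents (bcc : Cmd) : Prop :=
  ∀ (n : ℕ) (σ : State), σ.Valid n → ∃ (σ' : State) (t : ℕ), Exec bcc σ σ' t ∧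
    SameGraph σ σ' ∧
    σ'.Outputs n (twoConnectedComponents (σ.graph n).toSimpleGraphInclusive)

/-- The initial memory for the directed graph with `n` vertices and edge list `es`: the registers
`n` and `m` and the arrays of tails and heads hold the input, all other cells are zero. -/
def initState (n : ℕ) (es : List (Fin n × Fin n)) : State where
  reg r := match r with
    | Reg.n => n
    | Reg.m => es.length
    | _ => 0
  arr a i := match a with
    | Arr.src => (es.map fun p => (p.1 : ℕ)).getD i 0
    | Arr.dst => (es.map fun p => (p.2 : ℕ)).getD i 0
    | _ => 0

end ErSv

/-! The step count itself is short. One iteration of the main loop calls `scc` for the whole graph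
and for each of the n vertices, and sweeps the edge list after every call. With a linear-time `scc`
it therefore costs O((n + 1)(n + m + 1)). The flag is set only together with the deletion of a live
edge (`removeBetween_spec`), so an iteration that leaves it set lowers the number of live edges
(`iteration_spec`), and there are O(m + 1) iterations. As n ≥ 1, the additive ones are absorbed into
the constant. Nothing has to be proved about the intermediate graphs: the output is compared with
the graph that the memory finally holds. The real work is to exhibit the two subroutines and to
verify them.

Strongly connected components are found by a path-based depth-first search. The discovered vertices
without a label form a stack that is cut into segments. Going up the stack is always possible in the
graph, going down is possible inside a segment, explored arcs never lead to an earlier segment, and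
labelled vertices have only labelled successors (`Cfg.Inv`). An arc from the last segment to an
earlier one merges the last two segments (`Cfg.Inv.contract`). A last segment without unexplored
arcs is a component (`Cfg.Inv.popSegment`). The potential `Cfg.pot` pays for every step, so the
search is linear. Run on the symmetrised graph, the same search gives connected components.

The subroutine for 2-connected components may be slow, since the main loop already costs O(n(n + m))
per edge. The 2-connected components are the sets `blockOf H a b` with at least three elements, for
edges a b: the vertices that no single other vertex separates from a b
(`mem_twoConnectedComponents`). Such a set is found by one computation of connected components for
each deleted vertex. It is output only at its first edge; by `blockOf_eq` it was output before
exactly if it contains both ends of an earlier edge. -/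

namespace ErSv

/-! ### Reasoning about programs -/

/-- Started in `σ`, the program `c` halts within `K` steps in a memory that satisfies `Q`. -/
def Runs (c : Cmd) (σ : State) (K : ℕ) (Q : State → Prop) : Prop :=
  ∃ (σ' : State) (t : ℕ), Exec c σ σ' t ∧ t ≤ K ∧ Q σ'

theorem Runs.mono {c : Cmd} {σ : State} {K K' : ℕ} {Q Q' : State → Prop}
    (h : Runs c σ K Q) (hK : K ≤ K') (hQ : ∀ τ, Q τ → Q' τ) : Runs c σ K' Q' := by
  obtain ⟨σ', t, he, ht, hq⟩ := h
  exact ⟨σ', t, he, ht.trans hK, hQ _ hq⟩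

/-- With the run of `d` as the postcondition of `c`, a sequence is verified from left to right
without naming intermediate memories in advance. -/
theorem Runs.seq {c d : Cmd} {σ : State} {K₁ K₂ : ℕ} {Q : State → Prop}
    (h : Runs c σ K₁ fun τ => Runs d τ K₂ Q) : Runs (c ;; d) σ (K₁ + K₂) Q := by
  obtain ⟨σ₁, t₁, h₁, ht₁, σ₂, t₂, h₂, ht₂, hq⟩ := h
  exact ⟨σ₂, t₁ + t₂, Exec.seq h₁ h₂, by omega, hq⟩

theorem Runs.cond {b : Test} {c d : Cmd} {σ : State} {K : ℕ} {Q : State → Prop}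
    (h₁ : b.eval σ = true → Runs c σ K Q) (h₂ : b.eval σ = false → Runs d σ K Q) :
    Runs (Cmd.cond b c d) σ (b.cost + K) Q := by
  cases hb : b.eval σ with
  | true =>
    obtain ⟨σ₁, t, h, ht, hq⟩ := h₁ hb
    exact ⟨σ₁, _, Exec.cond_true hb h, by omega, hq⟩
  | false =>
    obtain ⟨σ₁, t, h, ht, hq⟩ := h₂ hb
    exact ⟨σ₁, _, Exec.cond_false hb h, by omega, hq⟩

/-- The program contains no loop. -/
def Cmd.loopFree : Cmd → Bool
  | .seq c d => c.loopFree && d.loopFree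
  | .cond _ c d => c.loopFree && d.loopFree
  | .while _ _ => false
  | _ => true

/-- The effect of a program without loops. -/
def Cmd.run : Cmd → State → State
  | .skip, σ => σ
  | .assign r t, σ => σ.setReg r (t.eval σ)
  | .store a i t, σ => σ.setArr a (i.eval σ) (t.eval σ)
  | .seq c d, σ => d.run (c.run σ)
  | .cond b c d, σ => if b.eval σ = true then c.run σ else d.run σ
  | .while _ _, σ => σ

/-- A bound on the running time of a program without loops. -/
def Cmd.maxCost : Cmd → ℕ
  | .skip => 1
  | .assign _ t => t.cost + 1
  | .store _ i t => i.cost + t.cost + 1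
  | .seq c d => c.maxCost + d.maxCost
  | .cond b c d => b.cost + max c.maxCost d.maxCost
  | .while _ _ => 0

theorem Cmd.exec_run {c : Cmd} (hc : c.loopFree = true) (σ : State) :
    ∃ t ≤ c.maxCost, Exec c σ (c.run σ) t := by
  induction c generalizing σ with
  | skip => exact ⟨_, le_rfl, .skip σ⟩
  | assign r t => exact ⟨_, le_rfl, .assign σ r t⟩
  | store a i t => exact ⟨_, le_rfl, .store σ a i t⟩
  | seq c d ihc ihd =>
    simp only [loopFree, Bool.and_eq_true] at hc
    obtain ⟨t₁, ht₁, h₁⟩ := ihc hc.1 σ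
    obtain ⟨t₂, ht₂, h₂⟩ := ihd hc.2 (c.run σ)
    exact ⟨t₁ + t₂, Nat.add_le_add ht₁ ht₂, .seq h₁ h₂⟩
  | cond b c d ihc ihd =>
    simp only [loopFree, Bool.and_eq_true] at hc
    cases hb : b.eval σ with
    | true =>
      obtain ⟨t, ht, h⟩ := ihc hc.1 σ
      refine ⟨_, ?_, by simpa [run, hb] using Exec.cond_true hb h⟩
      simp only [maxCost]; omega
    | false =>
      obtain ⟨t, ht, h⟩ := ihd hc.2 σ
      refine ⟨_, ?_, by simpa [run, hb] using Exec.cond_false hb h⟩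
      simp only [maxCost]; omega
  | _ b c => simp [loopFree] at hc

/-- Straight-line pieces are verified by computing their effect; their side conditions are closed by
`rfl`, and fixed cost bounds by `decide`. -/
theorem Runs.of_loopFree {c : Cmd} {σ : State} {Q : State → Prop}
    (hc : c.loopFree = true) (hQ : Q (c.run σ)) : Runs c σ c.maxCost Q := by
  obtain ⟨t, ht, h⟩ := Cmd.exec_run hc σ
  exact ⟨_, t, h, ht, hQ⟩

/-- Total correctness of a loop, with a potential that pays for the iterations. -/
theorem Runs.loop {b : Test} {c : Cmd} {I : ℕ → State → Prop} {K : ℕ}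
    (hstep : ∀ φ τ, I φ τ → b.eval τ = true →
      ∃ φ' d, φ' + (d + 1) ≤ φ ∧ Runs c τ (K * (d + 1)) (I φ'))
    (φ : ℕ) (σ : State) (h : I φ σ) :
    Runs (Cmd.while b c) σ ((K + b.cost) * φ + b.cost) fun τ =>
      b.eval τ = false ∧ ∃ φ', I φ' τ := by
  induction φ using Nat.strong_induction_on generalizing σ with
  | _ φ ih =>
    cases hb : b.eval σ with
    | false => exact ⟨σ, _, .while_false hb, by omega, hb, φ, h⟩
    | true =>
      obtain ⟨φ', d, hφ, σ₁, t₁, h₁, ht₁, hI⟩ := hstep φ σ h hb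
      obtain ⟨σ₂, t₂, h₂, ht₂, hq⟩ := ih φ' (by omega) σ₁ hI
      refine ⟨σ₂, _, .while_true hb h₁ h₂, ?_, hq⟩
      have h3 : (K + b.cost) * (φ' + (d + 1)) ≤ (K + b.cost) * φ := Nat.mul_le_mul_left _ hφ
      -- A round evaluates the test once, and the drop of the potential by at least one pays for
      -- that.
      have h4 : b.cost ≤ b.cost * (d + 1) := Nat.le_mul_of_pos_right _ (by omega)
      calc b.cost + t₁ + t₂
          ≤ b.cost * (d + 1) + K * (d + 1) + ((K + b.cost) * φ' + b.cost) := by omega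
        _ = (K + b.cost) * (φ' + (d + 1)) + b.cost := by ring
        _ ≤ _ := by omega

@[simp] theorem State.setReg_reg (σ : State) (r r' : Reg) (k : ℕ) :
    (σ.setReg r k).reg r' = if r' = r then k else σ.reg r' := by
  simp [State.setReg, Function.update_apply]

@[simp] theorem State.setReg_arr (σ : State) (r : Reg) (k : ℕ) :
    (σ.setReg r k).arr = σ.arr := rfl

@[simp] theorem State.setArr_reg (σ : State) (a : Arr) (i k : ℕ) :
    (σ.setArr a i k).reg = σ.reg := rfl

@[simp] theorem State.setArr_arr (σ : State) (a a' : Arr) (i k : ℕ) :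
    (σ.setArr a i k).arr a' =
      if a' = a then Function.update (σ.arr a) i k else σ.arr a' := by
  simp [State.setArr, Function.update_apply]

theorem Runs.forLoop {r bound : Reg} {c : Cmd} {I : ℕ → State → Prop} {N K : ℕ} {σ : State}
    (hr : r ≠ bound) (hN : σ.reg bound = N) (h0 : I 0 (σ.setReg r 0))
    (hstep : ∀ i < N, ∀ τ, τ.reg r = i → τ.reg bound = N → I i τ →
      Runs c τ K fun τ' => τ'.reg r = i ∧ τ'.reg bound = N ∧ I (i + 1) (τ'.setReg r (i + 1))) :
    Runs (forLoop r bound c) σ ((K + 6) * N + 5) (I N) := by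
  have key := Runs.loop (b := Test.lt (Expr.reg r) (Expr.reg bound))
    -- The increment takes 3 steps and the test 3, hence `K + 6` per round; the initial assignment
    -- (2) and the last test (3) give the 5. The potential is the number of rounds left.
    (c := c ;; Cmd.assign r (Expr.succ (Expr.reg r))) (K := K + 3)
    (I := fun φ τ => ∃ i, i + φ = N ∧ τ.reg r = i ∧ τ.reg bound = N ∧ I i τ) ?_ N
    (σ.setReg r 0) ⟨0, by omega, by simp, by simp [hr.symm, hN], h0⟩
  · refine Runs.mono (Runs.seq (Runs.mono (K' := 2) (Runs.of_loopFree rfl ?_) le_rfl fun _ h => h))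
      (K := 2 + ((K + 3 + 3) * N + 3)) (by ring_nf; omega) fun _ h => h
    refine Runs.mono key le_rfl ?_
    rintro τ ⟨hb, φ', i, h1, h2, h3, h4⟩
    simp only [Test.eval, Expr.eval, h2, h3, decide_eq_false_iff_not, not_lt] at hb
    obtain rfl : i = N := by omega
    exact h4
  · rintro φ τ ⟨i, h1, h2, h3, h4⟩ hb
    simp only [Test.eval, Expr.eval, h2, h3, decide_eq_true_eq] at hb
    refine ⟨φ - 1, 0, by omega, ?_⟩
    rw [zero_add, mul_one]
    refine Runs.seq ((hstep i hb τ h2 h3 h4).mono le_rfl ?_)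
    rintro τ' ⟨h5, h6, h7⟩
    refine Runs.of_loopFree (c := Cmd.assign r (Expr.succ (Expr.reg r))) rfl ?_
    simp only [Cmd.run, Expr.eval, h5]
    exact ⟨i + 1, by omega, by simp, by simp [hr.symm, h6], h7⟩

/-- The program does not write to the register `r`. -/
def Cmd.keepsReg (r : Reg) : Cmd → Bool
  | .assign r' _ => decide (r' ≠ r)
  | .seq c d => c.keepsReg r && d.keepsReg r
  | .cond _ c d => c.keepsReg r && d.keepsReg r
  | .while _ c => c.keepsReg r
  | _ => true

/-- The program does not write to the array `a`. -/
def Cmd.keepsArr (a : Arr) : Cmd → Bool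
  | .store a' _ _ => decide (a' ≠ a)
  | .seq c d => c.keepsArr a && d.keepsArr a
  | .cond _ c d => c.keepsArr a && d.keepsArr a
  | .while _ c => c.keepsArr a
  | _ => true

/-- For a concrete program `keepsReg` is evaluated by `rfl`, so invariants of loops need not mention
the registers that the body never writes. -/
theorem Exec.reg_eq {c : Cmd} {σ σ' : State} {t : ℕ} (h : Exec c σ σ' t) {r : Reg}
    (hc : c.keepsReg r = true) : σ'.reg r = σ.reg r := by
  induction h with
  | skip | store => rfl
  | assign σ r' t =>
    have : r' ≠ r := by simpa [Cmd.keepsReg] using hc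
    simp [this.symm]
  | seq _ _ ih₁ ih₂ =>
    simp only [Cmd.keepsReg, Bool.and_eq_true] at hc
    rw [ih₂ hc.2, ih₁ hc.1]
  | cond_true _ _ ih | cond_false _ _ ih =>
    simp only [Cmd.keepsReg, Bool.and_eq_true] at hc
    first | exact ih hc.1 | exact ih hc.2
  | while_false => rfl
  | while_true _ _ _ ih₁ ih₂ =>
    rw [ih₂ hc, ih₁ (by simpa [Cmd.keepsReg] using hc)]

theorem Exec.arr_eq {c : Cmd} {σ σ' : State} {t : ℕ} (h : Exec c σ σ' t) {a : Arr}
    (hc : c.keepsArr a = true) : σ'.arr a = σ.arr a := by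
  induction h with
  | skip | assign => rfl
  | store σ a' i t =>
    have : a' ≠ a := by simpa [Cmd.keepsArr] using hc
    simp [this.symm]
  | seq _ _ ih₁ ih₂ =>
    simp only [Cmd.keepsArr, Bool.and_eq_true] at hc
    rw [ih₂ hc.2, ih₁ hc.1]
  | cond_true _ _ ih | cond_false _ _ ih =>
    simp only [Cmd.keepsArr, Bool.and_eq_true] at hc
    first | exact ih hc.1 | exact ih hc.2
  | while_false => rfl
  | while_true _ _ _ ih₁ ih₂ =>
    rw [ih₂ hc, ih₁ (by simpa [Cmd.keepsArr] using hc)]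

/-- Registers and arrays that the program does not write to keep their contents. -/
theorem Runs.frame {c : Cmd} {σ : State} {K : ℕ} {Q : State → Prop} (h : Runs c σ K Q) :
    Runs c σ K fun τ => Q τ ∧ (∀ r, c.keepsReg r = true → τ.reg r = σ.reg r) ∧
      ∀ a, c.keepsArr a = true → τ.arr a = σ.arr a := by
  obtain ⟨σ', t, he, ht, hq⟩ := h
  exact ⟨σ', t, he, ht, hq, fun r hr => he.reg_eq hr, fun a ha => he.arr_eq ha⟩

/-! ### Strongly connected components by a path-based search -/

open Relation (ReflTransGen)

/-- The data of a path-based search for strongly connected components: `stk` holds at the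
positions `1, …, s` the discovered vertices without a label, `idx` is the position of a vertex in
`stk` (`0` if it is not discovered), `bnd` holds at `1, …, b` the positions at which the segments
of `stk` start, `pth` holds at `1, …, p` the vertices of `stk` that may have unexplored arcs,
`rem u` lists the heads of the unexplored arcs out of `u`, `comp` holds the labels (`0` if there
is none), `L` is the largest label, and the vertices below `v` have been discovered. -/
structure Cfg where
  (s b p v L : ℕ)
  (idx comp stk bnd pth : ℕ → ℕ)
  rem : ℕ → List ℕ

/-- The invariant of the path-based search in the graph `R` on the vertices `0, …, n - 1`. -/
structure Cfg.Inv (n : ℕ) (R : ℕ → ℕ → Prop) (c : Cfg) : Prop where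
  stk_spec : ∀ i, 1 ≤ i → i ≤ c.s → c.stk i < n ∧ c.idx (c.stk i) = i ∧ c.comp (c.stk i) = 0
  idx_spec : ∀ u < n, c.idx u ≠ 0 → c.comp u = 0 → c.idx u ≤ c.s ∧ c.stk (c.idx u) = u
  comp_zero : ∀ u < n, c.idx u = 0 → c.comp u = 0
  bnd_spec : ∀ j, 1 ≤ j → j ≤ c.b → 1 ≤ c.bnd j ∧ c.bnd j ≤ c.s
  bnd_lt : ∀ j j', 1 ≤ j → j < j' → j' ≤ c.b → c.bnd j < c.bnd j'
  bnd_one : 0 < c.s → 0 < c.b ∧ c.bnd 1 = 1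
  up : ∀ i j, 1 ≤ i → i ≤ j → j ≤ c.s → ReflTransGen R (c.stk i) (c.stk j)
  -- The condition on `l` says that no segment starts after `i` and up to `j`, that is, that the two
  -- positions lie in the same segment.
  down : ∀ i j, 1 ≤ i → i ≤ j → j ≤ c.s → (∀ l, 1 ≤ l → l ≤ c.b → c.bnd l ≤ j → c.bnd l ≤ i) →
    ReflTransGen R (c.stk j) (c.stk i)
  closed : ∀ u w, R u w → c.comp u ≠ 0 → c.comp w ≠ 0
  comp_le : ∀ u < n, c.comp u ≤ c.L
  comp_iff : ∀ u < n, ∀ w < n, c.comp u ≠ 0 → c.comp w ≠ 0 →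
    (c.comp u = c.comp w ↔ ReflTransGen R u w ∧ ReflTransGen R w u)
  rem_sub : ∀ u < n, ∀ w ∈ c.rem u, R u w
  -- Both ends of an explored arc are discovered; between vertices without labels it leads to the
  -- same or to a later segment.
  explored : ∀ u w, R u w → w ∉ c.rem u → c.idx u ≠ 0 ∧ c.idx w ≠ 0 ∧
    (c.comp u = 0 → c.comp w = 0 → ∀ l, 1 ≤ l → l ≤ c.b → c.bnd l ≤ c.idx u → c.bnd l ≤ c.idx w)
  pth_spec : ∀ j, 1 ≤ j → j ≤ c.p → c.pth j < n ∧ c.idx (c.pth j) ≠ 0 ∧ c.comp (c.pth j) = 0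
  pth_lt : ∀ j j', 1 ≤ j → j < j' → j' ≤ c.p → c.idx (c.pth j) < c.idx (c.pth j')
  pth_of : ∀ u < n, c.idx u ≠ 0 → c.comp u = 0 → c.rem u ≠ [] → ∃ j, 1 ≤ j ∧ j ≤ c.p ∧ c.pth j = u
  scan : ∀ u < c.v, c.idx u ≠ 0
  v_le : c.v ≤ n

/-- The work that remains to be done. -/
def Cfg.pot (n : ℕ) (c : Cfg) : ℕ :=
  (n - c.v) + ∑ u ∈ Finset.range n, (c.rem u).length +
    4 * ((Finset.range n).filter fun u => c.idx u = 0).card + c.s + c.b + c.p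

/-- Put the new vertex `w` on the stacks. -/
def Cfg.push (c : Cfg) (w : ℕ) : Cfg :=
  { c with
    s := c.s + 1, b := c.b + 1, p := c.p + 1
    idx := Function.update c.idx w (c.s + 1)
    stk := Function.update c.stk (c.s + 1) w
    bnd := Function.update c.bnd (c.b + 1) (c.s + 1)
    pth := Function.update c.pth (c.p + 1) w }

/-! ### The steps of the search preserve its invariant -/

namespace Cfg.Inv

variable {n : ℕ} {R : ℕ → ℕ → Prop} {c : Cfg}

/-- The new vertex is a segment of its own, so `down` asks nothing new, and `hs` extends `up`.
Explored arcs have discovered ends, hence neither end is `w`, and the new segment start lies above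
all of their positions. -/
theorem push (h : c.Inv n R) {w : ℕ} (hw : w < n) (hR : ∀ u w, R u w → u < n ∧ w < n)
    (h0 : c.idx w = 0)
    (hs : 0 < c.s → ReflTransGen R (c.stk c.s) w) : (c.push w).Inv n R := by
  have hcw := h.comp_zero w hw h0
  have hne : ∀ i, 1 ≤ i → i ≤ c.s → c.stk i ≠ w := fun i h1 h2 e => by
    have := (h.stk_spec i h1 h2).2.1; rw [e, h0] at this; omega
  have hpne : ∀ i, 1 ≤ i → i ≤ c.p → c.pth i ≠ w := fun i h1 h2 e => by
    have := (h.pth_spec i h1 h2).2.1; rw [e] at this; exact this h0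
  have hidx : ∀ u < n, c.comp u = 0 → c.idx u ≤ c.s := fun u hu hc => by
    by_cases hz : c.idx u = 0
    · omega
    · exact (h.idx_spec u hu hz hc).1
  constructor <;> simp only [Cfg.push, Function.update_apply]
  · intro i h1 h2
    have := h.stk_spec i h1
    have := hne i h1
    grind
  · intro u hu h1 h2
    have := h.idx_spec u hu
    grind
  · intro u hu h1
    have := h.comp_zero u hu
    grind
  · intro j h1 h2
    have := h.bnd_spec j h1
    grind
  · intro j j' h1 h2 h3
    have := h.bnd_lt j j' h1 h2
    have := h.bnd_spec j h1
    grind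
  · intro _
    have := h.bnd_one
    have : c.s = 0 → c.b = 0 := fun h0 => by
      by_contra hb
      have := h.bnd_spec 1 le_rfl (by omega)
      omega
    grind
  · intro i j h1 h2 h3
    by_cases hj : j = c.s + 1
    · by_cases hi : i = c.s + 1
      · simp only [hi, hj, if_true]; exact .refl
      · simp only [hi, hj, if_true, if_false]
        exact (h.up i c.s h1 (by omega) le_rfl).trans (hs (by omega))
    · have hi : i ≠ c.s + 1 := by omega
      simp only [hi, hj, if_false]
      exact h.up i j h1 h2 (by omega)
  · intro i j h1 h2 h3 h4
    by_cases hj : j = c.s + 1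
    · have := h4 (c.b + 1) (by omega) le_rfl (by simp [hj])
      simp only [if_true] at this
      have hi : i = c.s + 1 := by omega
      simp only [hi, hj, if_true]; exact .refl
    · have hi : i ≠ c.s + 1 := by omega
      simp only [hi, hj, if_false]
      refine h.down i j h1 h2 (by omega) fun l hl1 hl2 => ?_
      have := h4 l hl1 (by omega)
      rwa [if_neg (by omega)] at this
  · exact h.closed
  · exact h.comp_le
  · exact h.comp_iff
  · exact h.rem_sub
  · intro u w' h1 h2
    obtain ⟨h3, h4, h5⟩ := h.explored u w' h1 h2
    refine ⟨by split <;> omega, by split <;> omega, fun h6 h7 l hl1 hl2 => ?_⟩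
    have h8 := h5 h6 h7 l hl1
    have h9 := hidx u (hR _ _ h1).1 h6
    have : u ≠ w := by rintro rfl; exact h3 h0
    have : w' ≠ w := by rintro rfl; exact h4 h0
    grind
  · intro j h1 h2
    have := h.pth_spec j h1
    grind
  · intro j j' h1 h2 h3
    have := h.pth_lt j j' h1 h2
    have := hpne j h1
    have := hpne j' (by omega)
    have := h.pth_spec j h1 (by omega)
    have := hidx _ this.1 this.2.2
    grind
  · intro u hu h1 h2 h3
    by_cases huw : u = w
    · exact ⟨c.p + 1, by omega, le_rfl, by simp [huw]⟩
    · obtain ⟨j, hj1, hj2, hj3⟩ := h.pth_of u hu (by simpa [huw] using h1) h2 h3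
      exact ⟨j, hj1, by omega, by rw [if_neg (by omega), hj3]⟩
  · intro u hu
    have := h.scan u hu
    split <;> omega
  · exact h.v_le

/-- An arc to a labelled vertex, or to a vertex in the same or in a later segment, is explored. -/
theorem dropArc (h : c.Inv n R) {u w : ℕ} {l : List ℕ} (hrem : c.rem u = w :: l)
    (hu : u < n) (hiu : c.idx u ≠ 0) (hiw : c.idx w ≠ 0)
    (hw : c.comp w = 0 → ∀ l, 1 ≤ l → l ≤ c.b → c.bnd l ≤ c.idx u → c.bnd l ≤ c.idx w) :
    Cfg.Inv n R { c with rem := Function.update c.rem u l } := by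
  refine { h with rem_sub := ?_, explored := ?_, pth_of := ?_ }
  · intro u' hu' w' hw'
    by_cases e : u' = u
    · subst e
      simp only [Function.update_self] at hw'
      exact h.rem_sub _ hu' w' (by rw [hrem]; exact List.mem_cons_of_mem _ hw')
    · simp only [Function.update_of_ne e] at hw'
      exact h.rem_sub _ hu' w' hw'
  · intro u' w' hR' hw'
    by_cases e : u' = u
    · subst e
      simp only [Function.update_self] at hw'
      by_cases e' : w' = w
      · subst e'
        exact ⟨hiu, hiw, fun _ => hw⟩
      · exact h.explored _ _ hR' (by rw [hrem]; simp [e', hw'])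
    · simp only [Function.update_of_ne e] at hw'
      exact h.explored _ _ hR' hw'
  · intro u' hu' h1 h2 h3
    by_cases e : u' = u
    · subst e
      exact h.pth_of _ hu' h1 h2 (by rw [hrem]; simp)
    · simp only [Function.update_of_ne e] at h3
      exact h.pth_of _ hu' h1 h2 h3

/-- A vertex of the last segment reaches the last vertex of the stack. -/
theorem reach_top (h : c.Inv n R) {u j : ℕ} (hu : u < n) (hiu : c.idx u ≠ 0) (hcu : c.comp u = 0)
    (hb : c.bnd c.b ≤ c.idx u) (hj1 : 1 ≤ j) (hjs : j ≤ c.s) :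
    ReflTransGen R (c.stk j) u := by
  obtain ⟨h1, h2⟩ := h.idx_spec u hu hiu hcu
  rw [← h2]
  -- From a lower position one goes up. From a higher one, both positions lie in the last segment,
  -- because every start is at most the last start.
  rcases le_total j (c.idx u) with h3 | h3
  · exact h.up j _ hj1 h3 h1
  · refine h.down _ j (by omega) h3 hjs fun l hl1 hl2 _ => ?_
    rcases hl2.eq_or_lt with e | e
    · rw [e]; exact hb
    · exact (h.bnd_lt l c.b hl1 e le_rfl).le.trans hb

/-- An arc from the last segment to an earlier one merges the last two segments. -/
theorem contract (h : c.Inv n R) {u w : ℕ} (hR : R u w) (hu : u < n) (hw : w < n)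
    (hiu : c.idx u ≠ 0) (hcu : c.comp u = 0) (hiw : c.idx w ≠ 0) (hcw : c.comp w = 0)
    (hbu : c.bnd c.b ≤ c.idx u) (hbw : c.idx w < c.bnd c.b) :
    Cfg.Inv n R { c with b := c.b - 1 } := by
  obtain ⟨hw1, hw2⟩ := h.idx_spec w hw hiw hcw
  have hs : 0 < c.s := by omega
  obtain ⟨hb0, hb1⟩ := h.bnd_one hs
  -- The first segment starts at position 1, so a stack vertex before the last start needs an
  -- earlier segment.
  have hb : 1 < c.b := by
    by_contra hb
    obtain hb : c.b = 1 := by omega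
    rw [hb, hb1] at hbw; omega
  refine { h with bnd_spec := ?_, bnd_lt := ?_, bnd_one := ?_, down := ?_, explored := ?_ }
  · exact fun j h1 h2 => h.bnd_spec j h1 (by simp only at h2; omega)
  · exact fun j j' h1 h2 h3 => h.bnd_lt j j' h1 h2 (by simp only at h3; omega)
  · exact fun _ => ⟨by simp only; omega, hb1⟩
  · simp only
    intro i j h1 h2 h3 h4
    by_cases hcase : c.bnd c.b ≤ j → c.bnd c.b ≤ i
    · refine h.down i j h1 h2 h3 fun l hl1 hl2 => ?_
      rcases hl2.eq_or_lt with e | e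
      · rw [e]; exact hcase
      · exact h4 l hl1 (by omega)
    · push Not at hcase
      -- Now `j` lies in the last segment and `i` before it. The path goes from `j` to `u`, along
      -- the arc to `w`, and from `w` to `i`. If `i` is below `w`, this last part stays in one
      -- segment, because starts up to the position of `w` are also up to `j`, hence up to `i`.
      refine (h.reach_top hu hiu hcu hbu (by omega) h3).trans (.head hR ?_)
      rw [← hw2]
      rcases le_total (c.idx w) i with h5 | h5
      · exact h.up _ i (by omega) h5 (by omega)
      · refine h.down i _ h1 h5 hw1 fun l hl1 hl2 hl3 => ?_
        rcases hl2.eq_or_lt with e | e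
        · rw [e] at hl3; omega
        · exact h4 l hl1 (by omega) (by omega)
  · intro u' w' h1 h2
    obtain ⟨h3, h4, h5⟩ := h.explored u' w' h1 h2
    exact ⟨h3, h4, fun h6 h7 l hl1 hl2 => h5 h6 h7 l hl1 (by simp only at hl2; omega)⟩

/-- `pth_of` only asks for vertices with unexplored arcs, so an exhausted vertex may leave the path
while it stays on `stk`. -/
theorem popPath (h : c.Inv n R) (hp : 0 < c.p) (hrem : c.rem (c.pth c.p) = []) :
    Cfg.Inv n R { c with p := c.p - 1 } := by
  refine { h with pth_spec := ?_, pth_lt := ?_, pth_of := ?_ }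
  · exact fun j h1 h2 => h.pth_spec j h1 (by simp only at h2; omega)
  · exact fun j j' h1 h2 h3 => h.pth_lt j j' h1 h2 (by simp only at h3; omega)
  · intro u hu h1 h2 h3
    obtain ⟨j, hj1, hj2, hj3⟩ := h.pth_of u hu h1 h2 h3
    refine ⟨j, hj1, ?_, hj3⟩
    have : j ≠ c.p := by rintro rfl; rw [hj3] at hrem; exact h3 hrem
    simp only; omega

theorem next (h : c.Inv n R) (hv : c.v < n) (hi : c.idx c.v ≠ 0) :
    Cfg.Inv n R { c with v := c.v + 1 } := by
  refine { h with scan := ?_, v_le := hv }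
  intro u hu
  rcases Nat.lt_succ_iff_lt_or_eq.mp hu with h1 | rfl
  · exact h.scan u h1
  · exact hi

/-- When no arc out of the last segment is unexplored, it is a strongly connected component. -/
theorem popSegment (h : c.Inv n R) (hR : ∀ u w, R u w → u < n ∧ w < n) (hs : 0 < c.s)
    (hp : 0 < c.p → c.idx (c.pth c.p) < c.bnd c.b) {comp' : ℕ → ℕ}
    (h₁ : ∀ i, c.bnd c.b ≤ i → i ≤ c.s → comp' (c.stk i) = c.L + 1)
    (h₂ : ∀ z, (∀ i, c.bnd c.b ≤ i → i ≤ c.s → c.stk i ≠ z) → comp' z = c.comp z) :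
    Cfg.Inv n R { c with comp := comp', L := c.L + 1, s := c.bnd c.b - 1, b := c.b - 1 } := by
  obtain ⟨hb0, hb1⟩ := h.bnd_one hs
  obtain ⟨hT1, hTs⟩ := h.bnd_spec c.b hb0 le_rfl
  have hold : ∀ u < n, c.comp u ≠ 0 → comp' u = c.comp u := fun u hu h0 =>
    h₂ u fun i hi1 hi2 e => h0 (e ▸ (h.stk_spec i (by omega) hi2).2.2)
  have hnew : ∀ u < n, c.idx u ≠ 0 → c.comp u = 0 → c.bnd c.b ≤ c.idx u → comp' u = c.L + 1 := by
    intro u hu h1 h2 h3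
    obtain ⟨h4, h5⟩ := h.idx_spec u hu h1 h2
    rw [← h₁ _ h3 h4, h5]
  have hlow : ∀ u < n, c.comp u = 0 → c.idx u < c.bnd c.b → comp' u = 0 := by
    intro u hu h1 h2
    rw [h₂ u, h1]
    intro i hi1 hi2 e
    have := (h.stk_spec i (by omega) hi2).2.1
    rw [e] at this; omega
  -- A vertex was labelled before, or lies in the segment being removed, or has no label and lies
  -- below that segment or is undiscovered.
  have hcase : ∀ u < n, (c.comp u ≠ 0 ∧ comp' u = c.comp u) ∨
      (c.comp u = 0 ∧ c.idx u ≠ 0 ∧ c.bnd c.b ≤ c.idx u ∧ comp' u = c.L + 1) ∨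
      (c.comp u = 0 ∧ c.idx u < c.bnd c.b ∧ comp' u = 0) := by
    intro u hu
    by_cases h0 : c.comp u = 0
    · rcases lt_or_ge (c.idx u) (c.bnd c.b) with h1 | h1
      · exact .inr (.inr ⟨h0, h1, hlow u hu h0 h1⟩)
      · exact .inr (.inl ⟨h0, by omega, h1, hnew u hu (by omega) h0 h1⟩)
    · exact .inl ⟨h0, hold u hu h0⟩
  -- A vertex with unexplored arcs is on the path, where positions increase, and the last path
  -- vertex already lies before the segment.
  have hremnil : ∀ u < n, c.idx u ≠ 0 → c.comp u = 0 → c.bnd c.b ≤ c.idx u → c.rem u = [] := by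
    intro u hu h1 h2 h3
    by_contra h4
    obtain ⟨j, hj1, hj2, rfl⟩ := h.pth_of u hu h1 h2 h4
    have := hp (by omega)
    rcases hj2.eq_or_lt with e | e
    · rw [e] at h3; omega
    · have := h.pth_lt j c.p hj1 e le_rfl; omega
  have hbl : ∀ l, 1 ≤ l → l ≤ c.b → c.bnd l ≤ c.bnd c.b := fun l h1 h2 => by
    rcases h2.eq_or_lt with e | e
    · rw [e]
    · exact (h.bnd_lt l c.b h1 e le_rfl).le
  have hsame : ∀ u < n, ∀ w < n, c.idx u ≠ 0 → c.comp u = 0 → c.bnd c.b ≤ c.idx u → c.idx w ≠ 0 →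
      c.comp w = 0 → c.bnd c.b ≤ c.idx w → ReflTransGen R u w := by
    intro u hu w hw h1 h2 h3 h4 h5 h6
    obtain ⟨h7, h8⟩ := h.idx_spec u hu h1 h2
    have := h.reach_top hw h4 h5 h6 (by omega) h7
    rwa [h8] at this
  have hclosed : ∀ u w, ReflTransGen R u w → u < n → c.comp u ≠ 0 → c.comp w ≠ 0 := by
    intro u w hr _ h0
    induction hr with
    | refl => exact h0
    | tail _ h1 ih => exact h.closed _ _ h1 ih
  constructor <;> simp only
  · intro i h1 h2
    obtain ⟨h3, h4, h5⟩ := h.stk_spec i h1 (by omega)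
    exact ⟨h3, h4, hlow _ h3 h5 (by omega)⟩
  · intro u hu h1 h2
    rcases hcase u hu with h3 | h3 | h3
    · omega
    · omega
    · exact ⟨by omega, (h.idx_spec u hu h1 h3.1).2⟩
  · intro u hu h1
    have := h.comp_zero u hu h1
    rcases hcase u hu with h3 | h3 | h3 <;> omega
  · intro j h1 h2
    have := h.bnd_lt j c.b h1 (by omega) le_rfl
    have := h.bnd_spec j h1 (by omega)
    omega
  · exact fun j j' h1 h2 h3 => h.bnd_lt j j' h1 h2 (by omega)
  · intro h1
    refine ⟨?_, hb1⟩
    by_contra h2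
    have : c.b = 1 := by omega
    rw [this, hb1] at h1
    omega
  · exact fun i j h1 h2 h3 => h.up i j h1 h2 (by omega)
  · intro i j h1 h2 h3 h4
    refine h.down i j h1 h2 (by omega) fun l hl1 hl2 hl3 => ?_
    rcases hl2.eq_or_lt with e | e
    · rw [e] at hl3; omega
    · exact h4 l hl1 (by omega) hl3
  -- All arcs out of the removed segment are explored, so they lead to labelled vertices or to the
  -- same segment: no segment comes later.
  · intro u w huw h1
    obtain ⟨hu, hw⟩ := hR _ _ huw
    rcases hcase u hu with h3 | h3 | h3
    · rw [hold w hw (h.closed u w huw h3.1)]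
      exact h.closed u w huw h3.1
    · obtain ⟨h4, h5, h6⟩ := h.explored u w huw (by rw [hremnil u hu h3.2.1 h3.1 h3.2.2.1]; simp)
      by_cases h7 : c.comp w = 0
      · rw [hnew w hw h5 h7 (h6 h3.1 h7 c.b hb0 le_rfl h3.2.2.1)]; omega
      · rwa [hold w hw h7]
    · omega
  · intro u hu
    have := h.comp_le u hu
    rcases hcase u hu with h3 | h3 | h3 <;> omega
  · intro u hu w hw hu0 hw0
    have hlu := h.comp_le u hu
    have hlw := h.comp_le w hw
    rcases hcase u hu with h3 | h3 | h3 <;> rcases hcase w hw with h4 | h4 | h4 <;>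
      try omega
    · rw [h3.2, h4.2]; exact h.comp_iff u hu w hw h3.1 h4.1
    -- Old labels are at most `L`, so they differ from the new one. A vertex labelled earlier
    -- reaches only vertices labelled earlier, so it shares no component with the new ones.
    · refine ⟨fun h5 => by omega, fun h5 => ?_⟩
      exact absurd h4.1 (hclosed _ _ h5.1 hu h3.1)
    · refine ⟨fun h5 => by omega, fun h5 => ?_⟩
      exact absurd h3.1 (hclosed _ _ h5.2 hw h4.1)
    · refine ⟨fun _ => ⟨?_, ?_⟩, fun h5 => by omega⟩
      · exact hsame u hu w hw h3.2.1 h3.1 h3.2.2.1 h4.2.1 h4.1 h4.2.2.1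
      · exact hsame w hw u hu h4.2.1 h4.1 h4.2.2.1 h3.2.1 h3.1 h3.2.2.1
  · exact h.rem_sub
  · intro u w huw h1
    obtain ⟨hu, hw⟩ := hR _ _ huw
    obtain ⟨h2, h3, h4⟩ := h.explored u w huw h1
    refine ⟨h2, h3, fun h5 h6 l hl1 hl2 => ?_⟩
    rcases hcase u hu with h7 | h7 | h7 <;> rcases hcase w hw with h8 | h8 | h8 <;> try omega
    exact h4 h7.1 h8.1 l hl1 (by omega)
  · intro j h1 h2
    obtain ⟨h3, h4, h5⟩ := h.pth_spec j h1 h2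
    refine ⟨h3, h4, hlow _ h3 h5 ?_⟩
    have := hp (by omega)
    rcases h2.eq_or_lt with e | e
    · rw [e]; omega
    · have := h.pth_lt j c.p h1 e le_rfl; omega
  · exact h.pth_lt
  · intro u hu h1 h2 h3
    refine h.pth_of u hu h1 ?_ h3
    rcases hcase u hu with h7 | h7 | h7 <;> omega
  · exact h.scan
  · exact h.v_le

/-- At the end, the labels are those of the strongly connected components. -/
theorem final (h : c.Inv n R) (hs : c.s = 0) (hv : n ≤ c.v) :
    ∀ u < n, ∀ w < n, (c.comp u = c.comp w ↔ ReflTransGen R u w ∧ ReflTransGen R w u) := by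
  have key : ∀ u < n, c.comp u ≠ 0 := fun u hu h0 => by
    have h1 := h.scan u (by omega)
    have := (h.idx_spec u hu h1 h0).1
    omega
  exact fun u hu w hw => h.comp_iff u hu w hw (key u hu) (key w hw)

/-- The configuration at the start. -/
theorem start {rem : ℕ → List ℕ} {idx comp stk bnd pth : ℕ → ℕ}
    (hR : ∀ u w, R u w → u < n ∧ w < n) (hidx : ∀ u < n, idx u = 0) (hcomp : ∀ u < n, comp u = 0)
    (hrem : ∀ u < n, ∀ w, w ∈ rem u ↔ R u w) :
    Cfg.Inv n R ⟨0, 0, 0, 0, 0, idx, comp, stk, bnd, pth, rem⟩ := by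
  constructor <;> simp only
  · intros; omega
  · exact fun u hu h1 => absurd (hidx u hu) h1
  · exact fun u hu _ => hcomp u hu
  · intros; omega
  · intros; omega
  · intros; omega
  · intros; omega
  · intros; omega
  · exact fun u w h1 h2 => absurd (hcomp u (hR _ _ h1).1) h2
  · exact fun u hu => (hcomp u hu).le
  · exact fun u hu w hw h1 => absurd (hcomp u hu) h1
  · exact fun u hu w => (hrem u hu w).1
  · exact fun u w h1 h2 => absurd ((hrem u (hR _ _ h1).1 w).2 h1) h2
  · intros; omega
  · intros; omega
  · exact fun u hu h1 => absurd (hidx u hu) h1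
  · intros; omega
  · omega

end Cfg.Inv

/-! ### The potential of the search -/

/-- This explains the weight 4 of an undiscovered vertex: a push makes three stacks longer by one
each and must still release one unit. -/
theorem Cfg.pot_push {n : ℕ} {c : Cfg} {w : ℕ} (hw : w < n) (h0 : c.idx w = 0) :
    (c.push w).pot n + 1 = c.pot n := by
  have h1 : ((Finset.range n).filter fun u => (c.push w).idx u = 0) =
      ((Finset.range n).filter fun u => c.idx u = 0).erase w := by
    ext u
    simp only [Cfg.push, Function.update_apply, Finset.mem_filter, Finset.mem_erase]
    by_cases e : u = w <;> simp [e]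
  have hmem : w ∈ (Finset.range n).filter fun u => c.idx u = 0 := by simp [hw, h0]
  have h2 := Finset.card_erase_of_mem hmem
  have h3 := Finset.card_pos.mpr ⟨w, hmem⟩
  simp only [Cfg.pot, h1, h2]
  simp only [Cfg.push]
  omega

theorem Cfg.pot_dropArc {n : ℕ} {c : Cfg} {u w : ℕ} {l : List ℕ} (hu : u < n)
    (hrem : c.rem u = w :: l) :
    Cfg.pot n { c with rem := Function.update c.rem u l } + 1 = c.pot n := by
  have hmem : u ∈ Finset.range n := by simpa using hu
  have h1 := Finset.sum_erase_add (Finset.range n) (fun u => (c.rem u).length) hmem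
  have h2 := Finset.sum_erase_add (Finset.range n)
    (fun u' => (Function.update c.rem u l u').length) hmem
  have h3 : ∑ u' ∈ (Finset.range n).erase u, (Function.update c.rem u l u').length =
      ∑ u' ∈ (Finset.range n).erase u, (c.rem u').length :=
    Finset.sum_congr rfl fun x hx => by rw [Function.update_of_ne (Finset.ne_of_mem_erase hx)]
  simp only [hrem, Function.update_self, List.length_cons] at h1 h2
  simp only [Cfg.pot]
  omega

/-! ### The subroutine for strongly connected components -/

/-- size of `aStk` -/
@[simp] abbrev rS : Reg := .tmp 0
/-- size of `aBnd` -/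
@[simp] abbrev rB : Reg := .tmp 1
/-- size of `aPth` -/
@[simp] abbrev rP : Reg := .tmp 2
/-- loop variable running over the vertices -/
@[simp] abbrev rV : Reg := .tmp 3
/-- the largest label -/
@[simp] abbrev rL : Reg := .tmp 4
/-- tail of the explored arc -/
@[simp] abbrev rU : Reg := .tmp 5
/-- head of the explored arc -/
@[simp] abbrev rW : Reg := .tmp 6
/-- number of arcs in the adjacency lists -/
@[simp] abbrev rK : Reg := .tmp 7
/-- start of the last segment -/
@[simp] abbrev rT : Reg := .tmp 8
/-- first arcs of the adjacency lists -/
@[simp] abbrev aHead : Arr := .tmp 0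
/-- next arcs in the adjacency lists -/
@[simp] abbrev aNxt : Arr := .tmp 1
/-- heads of the arcs -/
@[simp] abbrev aTgt : Arr := .tmp 2
/-- positions in `aStk` -/
@[simp] abbrev aIdx : Arr := .tmp 3
/-- discovered vertices without a label -/
@[simp] abbrev aStk : Arr := .tmp 4
/-- starts of the segments of `aStk` -/
@[simp] abbrev aBnd : Arr := .tmp 5
/-- vertices of `aStk` that may have unexplored arcs -/
@[simp] abbrev aPth : Arr := .tmp 6

/-- `r := r + 1` -/
def incr (r : Reg) : Cmd := .assign r (.succ (.reg r))

/-- `r := r - 1` -/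
def decr (r : Reg) : Cmd := .assign r (.pred (.reg r))

/-- Put the vertex in `rW` on the stacks. -/
def pushCmd : Cmd :=
  incr rS ;; .store aStk (.reg rS) (.reg rW) ;; .store aIdx (.reg rW) (.reg rS) ;;
  incr rB ;; .store aBnd (.reg rB) (.reg rS) ;;
  incr rP ;; .store aPth (.reg rP) (.reg rW)

/-- Look for the next vertex that is not discovered. -/
def scanCmd : Cmd :=
  .cond (.eq (.get aIdx (.reg rV)) (.const 0)) (.assign rW (.reg rV) ;; pushCmd) (incr rV)

/-- Explore the next arc out of the last vertex of `aPth`. -/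
def exploreCmd : Cmd :=
  .assign rU (.get aPth (.reg rP)) ;;
  .cond (.eq (.get aHead (.reg rU)) (.const 0)) (decr rP)
    (.assign rW (.get aTgt (.get aHead (.reg rU))) ;;
      .cond (.and (.eq (.get .comp (.reg rW)) (.const 0))
          (.and (.not (.eq (.get aIdx (.reg rW)) (.const 0)))
            (.lt (.get aIdx (.reg rW)) (.get aBnd (.reg rB)))))
        (decr rB)
        (.store aHead (.reg rU) (.get aNxt (.get aHead (.reg rU))) ;;
          .cond (.eq (.get aIdx (.reg rW)) (.const 0)) pushCmd .skip))

/-- Label the vertices of `aStk` from the position `rT` on, and remove them. -/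
def labelLoop : Cmd :=
  .while (.not (.lt (.reg rS) (.reg rT)))
    (.store .comp (.get aStk (.reg rS)) (.reg rL) ;; decr rS)

/-- Label and remove the last segment. -/
def popCmd : Cmd :=
  (incr rL ;; .assign rT (.get aBnd (.reg rB)) ;; decr rB) ;; labelLoop

/-- Is the last vertex of `aPth` in the last segment? -/
def hasPath : Test :=
  .and (.lt (.const 0) (.reg rP))
    (.not (.lt (.get aIdx (.get aPth (.reg rP))) (.get aBnd (.reg rB))))

/-- One step of the search. -/
def searchStep : Cmd :=
  .cond (.eq (.reg rS) (.const 0)) scanCmd (.cond hasPath exploreCmd popCmd)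

/-- The search is not finished. -/
def searchTest : Test :=
  .not (.and (.eq (.reg rS) (.const 0)) (.not (.lt (.reg rV) (.reg .n))))

/-- Compute the strongly connected components of the graph given by the adjacency lists. -/
def search : Cmd :=
  (.assign rS (.const 0) ;; .assign rB (.const 0) ;; .assign rP (.const 0) ;;
    .assign rV (.const 0) ;; .assign rL (.const 0)) ;;
  .while searchTest searchStep

/-- Starting with the arc number `p`, the linked list in the arrays `nxt` and `tgt` has the
entries `l`; only the arcs `1, …, k` are used. -/
def Chain (nxt tgt : ℕ → ℕ) (k : ℕ) : ℕ → List ℕ → Prop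
  | p, [] => p = 0
  | p, w :: l => p ≠ 0 ∧ p ≤ k ∧ tgt p = w ∧ Chain nxt tgt k (nxt p) l

/-- The list uses only cells up to `k`, so writing to the fresh cell `k + 1` does not disturb it. -/
theorem Chain.extend {nxt tgt : ℕ → ℕ} {k p : ℕ} {l : List ℕ} (h : Chain nxt tgt k p l)
    (q w : ℕ) : Chain (Function.update nxt (k + 1) q) (Function.update tgt (k + 1) w) (k + 1) p l := by
  induction l generalizing p with
  | nil => exact h
  | cons w' l ih =>
    obtain ⟨h1, h2, h3, h4⟩ := h
    refine ⟨h1, by omega, ?_, ?_⟩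
    · rw [Function.update_of_ne (by omega), h3]
    · rw [Function.update_of_ne (by omega)]
      exact ih h4

/-- The memory holds the adjacency lists `rem`. -/
def State.HasLists (σ : State) (n : ℕ) (rem : ℕ → List ℕ) : Prop :=
  ∀ u < n, Chain (σ.arr aNxt) (σ.arr aTgt) (σ.reg rK) (σ.arr aHead u) (rem u)

/-- The memory holds the configuration `c` of the search. -/
structure Cfg.Rep (n : ℕ) (c : Cfg) (σ : State) : Prop where
  n_eq : σ.reg .n = n
  s_eq : σ.reg rS = c.s
  b_eq : σ.reg rB = c.b
  p_eq : σ.reg rP = c.p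
  v_eq : σ.reg rV = c.v
  L_eq : σ.reg rL = c.L
  idx_eq : σ.arr aIdx = c.idx
  comp_eq : σ.arr .comp = c.comp
  stk_eq : σ.arr aStk = c.stk
  bnd_eq : σ.arr aBnd = c.bnd
  pth_eq : σ.arr aPth = c.pth
  lists : σ.HasLists n c.rem

theorem Runs.cond_true {b : Test} {c d : Cmd} {σ : State} {K : ℕ} {Q : State → Prop}
    (hb : b.eval σ = true) (h : Runs c σ K Q) : Runs (Cmd.cond b c d) σ (b.cost + K) Q :=
  Runs.cond (fun _ => h) fun h' => by simp [hb] at h'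

theorem Runs.cond_false {b : Test} {c d : Cmd} {σ : State} {K : ℕ} {Q : State → Prop}
    (hb : b.eval σ = false) (h : Runs d σ K Q) : Runs (Cmd.cond b c d) σ (b.cost + K) Q :=
  Runs.cond (fun h' => by simp [hb] at h') fun _ => h

/-! ### Correctness and amortised cost of the search program -/

section

variable {n : ℕ} {c : Cfg} {τ : State}

theorem Cfg.Rep.push (h : c.Rep n τ) : (c.push (τ.reg rW)).Rep n (pushCmd.run τ) := by
  obtain ⟨h1, h2, h3, h4, h5, h6, h7, h8, h9, h10, h11, h12⟩ := h
  constructor <;>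
    simp_all [pushCmd, incr, Cmd.run, Expr.eval, Cfg.push, State.HasLists]

theorem Cfg.Rep.scan_push (h : c.Rep n τ) (h0 : c.idx c.v = 0) :
    (c.push c.v).Rep n (scanCmd.run τ) := by
  have h1 : scanCmd.run τ = pushCmd.run (τ.setReg rW (τ.reg rV)) := by
    have := h.idx_eq
    have := h.v_eq
    simp_all [scanCmd, Cmd.run, Expr.eval, Test.eval]
  have h2 : c.Rep n (τ.setReg rW (τ.reg rV)) := by
    obtain ⟨h1, h2, h3, h4, h5, h6, h7, h8, h9, h10, h11, h12⟩ := h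
    constructor <;> simp_all [State.HasLists]
  have := h2.push
  rw [h1]
  simpa [h.v_eq] using this

theorem Cfg.Rep.scan_next (h : c.Rep n τ) (h0 : c.idx c.v ≠ 0) :
    Cfg.Rep n { c with v := c.v + 1 } (scanCmd.run τ) := by
  obtain ⟨h1, h2, h3, h4, h5, h6, h7, h8, h9, h10, h11, h12⟩ := h
  constructor <;> simp_all [scanCmd, incr, Cmd.run, Expr.eval, Test.eval, State.HasLists]

theorem Cfg.Rep.explore_nil (h : c.Rep n τ) (hu : c.pth c.p < n) (h0 : c.rem (c.pth c.p) = []) :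
    Cfg.Rep n { c with p := c.p - 1 } (exploreCmd.run τ) := by
  obtain ⟨h1, h2, h3, h4, h5, h6, h7, h8, h9, h10, h11, h12⟩ := h
  have h13 := h12 _ hu
  rw [h0] at h13
  simp only [Chain] at h13
  constructor <;> simp_all [exploreCmd, decr, Cmd.run, Expr.eval, Test.eval, State.HasLists]

/-- The arc stays in its list: each step merges only two segments, and the same arc is examined
again until its head lies in the last segment. The decrease of `b` pays for the repetition. -/
theorem Cfg.Rep.explore_contract (h : c.Rep n τ) (hu : c.pth c.p < n) {w : ℕ} {l : List ℕ}
    (h0 : c.rem (c.pth c.p) = w :: l) (hw : c.comp w = 0) (hi : c.idx w ≠ 0)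
    (hb : c.idx w < c.bnd c.b) :
    Cfg.Rep n { c with b := c.b - 1 } (exploreCmd.run τ) := by
  obtain ⟨h1, h2, h3, h4, h5, h6, h7, h8, h9, h10, h11, h12⟩ := h
  have h13 := h12 _ hu
  rw [h0] at h13
  obtain ⟨h14, -, h15, -⟩ := h13
  constructor <;> simp_all [exploreCmd, decr, Cmd.run, Expr.eval, Test.eval, State.HasLists]

theorem Cfg.Rep.explore_drop (h : c.Rep n τ) (hu : c.pth c.p < n) {w : ℕ} {l : List ℕ}
    (h0 : c.rem (c.pth c.p) = w :: l) (hw : ¬ (c.comp w = 0 ∧ c.idx w ≠ 0 ∧ c.idx w < c.bnd c.b)) :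
    Cfg.Rep n
      (if c.idx w = 0 then { c.push w with rem := Function.update c.rem (c.pth c.p) l }
        else { c with rem := Function.update c.rem (c.pth c.p) l }) (exploreCmd.run τ) := by
  have h13 := h.lists _ hu
  rw [h0] at h13
  obtain ⟨h14, -, h15, h16⟩ := h13
  set τ' := ((τ.setReg rU (c.pth c.p)).setReg rW w).setArr aHead (c.pth c.p)
    (τ.arr aNxt (τ.arr aHead (c.pth c.p))) with hτ'
  have h17 : exploreCmd.run τ = if c.idx w = 0 then pushCmd.run τ' else τ' := by
    obtain ⟨h1, h2, h3, h4, h5, h6, h7, h8, h9, h10, h11, h12⟩ := h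
    simp_all [exploreCmd, Cmd.run, Expr.eval, Test.eval]
  have h18 : Cfg.Rep n { c with rem := Function.update c.rem (c.pth c.p) l } τ' := by
    obtain ⟨h1, h2, h3, h4, h5, h6, h7, h8, h9, h10, h11, h12⟩ := h
    constructor <;> try simp_all
    intro u hu'
    by_cases e : u = c.pth c.p
    · subst e; simpa using h16
    · simpa [e] using h12 u hu'
  rw [h17]
  split
  · have := h18.push
    rwa [show τ'.reg rW = w by simp [hτ']] at this
  · exact h18

/-- The effect of labelling the last segment. -/
theorem Cfg.Rep.pop (h : c.Rep n τ) (hT : 1 ≤ c.bnd c.b) (hTs : c.bnd c.b ≤ c.s) :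
    Runs popCmd τ (20 * (c.s - (c.bnd c.b - 1) + 1)) fun τ' =>
      ∃ comp', (∀ i, c.bnd c.b ≤ i → i ≤ c.s → comp' (c.stk i) = c.L + 1) ∧
        (∀ z, (∀ i, c.bnd c.b ≤ i → i ≤ c.s → c.stk i ≠ z) → comp' z = c.comp z) ∧
        Cfg.Rep n { c with comp := comp', L := c.L + 1, s := c.bnd c.b - 1, b := c.b - 1 } τ' := by
  obtain ⟨h1, h2, h3, h4, h5, h6, h7, h8, h9, h10, h11, h12⟩ := h
  refine Runs.mono (Runs.seq (Runs.of_loopFree rfl (Runs.frame (Runs.loop (K := 7)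
    -- The potential is the number of vertices of the segment that still await their label.
    (I := fun φ τ' => φ + (c.bnd c.b - 1) = τ'.reg rS ∧ τ'.reg rS ≤ c.s ∧ τ'.reg rT = c.bnd c.b ∧
      τ'.reg rL = c.L + 1 ∧ τ'.arr aStk = c.stk ∧
      (∀ i, τ'.reg rS < i → i ≤ c.s → τ'.arr .comp (c.stk i) = c.L + 1) ∧
      (∀ z, (∀ i, τ'.reg rS < i → i ≤ c.s → c.stk i ≠ z) → τ'.arr .comp z = c.comp z))
    ?_ (c.s - (c.bnd c.b - 1)) _ ?_)))) ?_ ?_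
  · rintro φ τ' ⟨i1, i2, i3, i4, i5, i6, i7⟩ hb
    simp only [Test.eval, Expr.eval, i3, Bool.not_eq_true', decide_eq_false_iff_not, not_lt] at hb
    refine ⟨φ - 1, 0, by omega, Runs.mono (Runs.of_loopFree rfl ?_) (by decide) fun _ h => h⟩
    simp only [rS, rT, rL, aStk] at *
    simp only [decr, Cmd.run, Expr.eval, State.setReg_reg, State.setReg_arr, State.setArr_arr,
      State.setArr_reg, i5, i4, if_true]
    simp only [reduceCtorEq, Reg.tmp.injEq, if_false, OfNat.ofNat_ne_zero, i3,
      Function.update_apply, true_and]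
    refine ⟨by omega, by omega, fun i hi1 hi2 => ?_, fun z hz => ?_⟩
    · by_cases e : i = τ'.reg (.tmp 0)
      · simp [e]
      · split
        · rfl
        · exact i6 i (by omega) hi2
    · rw [if_neg (fun e => hz _ (by omega) i2 e.symm)]
      exact i7 z fun i hi1 hi2 => hz i (by omega) hi2
  · simp only [incr, decr, Cmd.run, Expr.eval, rS, rT, rL, rB, aStk, aBnd, State.setReg_reg,
      State.setReg_arr, reduceCtorEq, Reg.tmp.injEq, if_false, if_true, Nat.reduceEqDiff,
      OfNat.zero_ne_ofNat, OfNat.ofNat_ne_one]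
    simp only [rS, rB, rL, aStk, aBnd] at h2 h3 h6 h9 h10
    rw [h2, h3, h6, h8, h9, h10]
    exact ⟨by omega, le_rfl, rfl, rfl, rfl, fun i hi1 hi2 => by omega, fun z _ => rfl⟩
  · simp only [Cmd.maxCost, incr, decr, Expr.cost, Test.cost]
    ring_nf; omega
  · rintro τ' ⟨⟨hb, φ, i1, i2, i3, i4, i5, i6, i7⟩, hr, ha⟩
    simp only [Test.eval, Expr.eval, i3, Bool.not_eq_false', decide_eq_true_eq] at hb
    have hs : τ'.reg rS = c.bnd c.b - 1 := by omega
    rw [hs] at i6 i7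
    refine ⟨τ'.arr .comp, fun i hi1 hi2 => i6 i (by omega) hi2,
      fun z hz => i7 z fun i hi1 hi2 => hz i (by omega) hi2, ?_⟩
    have run_reg : ∀ r, r ≠ rL → r ≠ rT → r ≠ rB →
        (Cmd.run (incr rL ;; .assign rT (.get aBnd (.reg rB)) ;; decr rB) τ).reg r = τ.reg r := by
      intro r r1 r2 r3
      simp only [incr, decr, Cmd.run, State.setReg_reg, r1, r2, r3, if_false]
    constructor
    · exact (hr .n rfl).trans ((run_reg _ (by decide) (by decide) (by decide)).trans h1)
    · exact hs
    · refine (hr rB rfl).trans ?_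
      simp only [rB] at h3
      simp [incr, decr, Cmd.run, Expr.eval, h3]
    · exact (hr rP rfl).trans ((run_reg _ (by decide) (by decide) (by decide)).trans h4)
    · exact (hr rV rfl).trans ((run_reg _ (by decide) (by decide) (by decide)).trans h5)
    · exact i4
    · exact (ha aIdx rfl).trans h7
    · rfl
    · exact i5
    · exact (ha aBnd rfl).trans h10
    · exact (ha aPth rfl).trans h11
    · intro u hu
      rw [ha aHead rfl, ha aNxt rfl, ha aTgt rfl, hr rK rfl,
        run_reg _ (by decide) (by decide) (by decide)]
      exact h12 u hu

theorem searchStep_spec {R : ℕ → ℕ → Prop} (hR : ∀ u w, R u w → u < n ∧ w < n) (φ : ℕ)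
    (h : ∃ c : Cfg, c.Rep n τ ∧ c.Inv n R ∧ c.pot n = φ) (hb : searchTest.eval τ = true) :
    ∃ φ' d, φ' + (d + 1) ≤ φ ∧ Runs searchStep τ (90 * (d + 1)) fun τ' =>
      ∃ c : Cfg, c.Rep n τ' ∧ c.Inv n R ∧ c.pot n = φ' := by
  obtain ⟨c, hrep, hinv, rfl⟩ := h
  by_cases hs : c.s = 0
  · have ht : (Test.eq (.reg rS) (.const 0)).eval τ = true := by
      simpa [Test.eval, Expr.eval, hrep.s_eq] using hs
    have hv : c.v < n := by
      have e1 := hrep.s_eq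
      have e2 := hrep.v_eq
      have e3 := hrep.n_eq
      simp_all [searchTest, Test.eval, Expr.eval]
    by_cases h0 : c.idx c.v = 0
    · have := Cfg.pot_push hv h0
      exact ⟨_, 0, this.le, Runs.mono (Runs.cond_true ht (Runs.of_loopFree rfl
        ⟨_, hrep.scan_push h0, hinv.push hv hR h0 (by omega), rfl⟩)) (by decide) fun _ h => h⟩
    · refine ⟨_, 0, ?_, Runs.mono (Runs.cond_true ht (Runs.of_loopFree rfl
        ⟨_, hrep.scan_next h0, hinv.next hv h0, rfl⟩)) (by decide) fun _ h => h⟩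
      simp only [Cfg.pot]; omega
  · have ht : (Test.eq (.reg rS) (.const 0)).eval τ = false := by
      simpa [Test.eval, Expr.eval, hrep.s_eq] using hs
    obtain ⟨hb0, -⟩ := hinv.bnd_one (by omega)
    obtain ⟨hT1, hT2⟩ := hinv.bnd_spec c.b hb0 le_rfl
    have hpath : hasPath.eval τ = true ↔ 0 < c.p ∧ c.bnd c.b ≤ c.idx (c.pth c.p) := by
      have e1 := hrep.p_eq
      have e2 := hrep.b_eq
      have e3 := hrep.idx_eq
      have e4 := hrep.pth_eq
      have e5 := hrep.bnd_eq
      simp_all [hasPath, Test.eval, Expr.eval]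
    by_cases hp : 0 < c.p ∧ c.bnd c.b ≤ c.idx (c.pth c.p)
    · have ht' := hpath.2 hp
      obtain ⟨hp0, hp1⟩ := hp
      obtain ⟨hu, hiu, hcu⟩ := hinv.pth_spec c.p hp0 le_rfl
      cases hrem : c.rem (c.pth c.p) with
      | nil =>
        refine ⟨_, 0, ?_, Runs.mono (Runs.cond_false ht (Runs.cond_true ht' (Runs.of_loopFree rfl
          ⟨_, hrep.explore_nil hu hrem, hinv.popPath hp0 hrem, rfl⟩))) (by decide) fun _ h => h⟩
        simp only [Cfg.pot]; omega
      | cons w l =>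
        have huw : R (c.pth c.p) w := hinv.rem_sub _ hu w (by simp [hrem])
        have hw := (hR _ _ huw).2
        by_cases hc : c.comp w = 0 ∧ c.idx w ≠ 0 ∧ c.idx w < c.bnd c.b
        · refine ⟨_, 0, ?_, Runs.mono (Runs.cond_false ht (Runs.cond_true ht' (Runs.of_loopFree rfl
            ⟨_, hrep.explore_contract hu hrem hc.1 hc.2.1 hc.2.2,
              hinv.contract huw hu hw hiu hcu hc.2.1 hc.1 hp1 hc.2.2, rfl⟩)))
            (by decide) fun _ h => h⟩
          simp only [Cfg.pot]; omega
        · have hrep' := hrep.explore_drop hu hrem hc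
          by_cases h0 : c.idx w = 0
          · rw [if_pos h0] at hrep'
            have hne : c.pth c.p ≠ w := fun e => hiu (e ▸ h0)
            -- The top of the stack reaches `u`, which lies in the last segment, and then `w` along
            -- the arc. The push comes before the arc is dropped, since a dropped arc must have a
            -- discovered head; afterwards `w` is the top of the stack and no segment starts above
            -- it.
            have hpush := hinv.push hw hR h0 fun hs' =>
              (hinv.reach_top hu hiu hcu hp1 hs' le_rfl).tail huw
            have hidx : c.idx (c.pth c.p) ≤ c.s := (hinv.idx_spec _ hu hiu hcu).1
            have hdrop := hpush.dropArc (u := c.pth c.p) (w := w) (l := l) hrem hu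
              (by simpa [Cfg.push, hne] using hiu) (by simp [Cfg.push]) (fun _ j hj1 hj2 _ => by
                simp only [Cfg.push, Function.update_apply, if_true] at hj2 ⊢
                split
                · exact le_rfl
                · have := (hinv.bnd_spec j hj1 (by omega)).2
                  omega)
            have p1 := Cfg.pot_push hw h0
            have p2 := Cfg.pot_dropArc (c := c.push w) hu hrem
            refine ⟨_, 0, ?_, Runs.mono (Runs.cond_false ht (Runs.cond_true ht'
              (Runs.of_loopFree rfl ⟨_, hrep', hdrop, rfl⟩))) (by decide) fun _ h => h⟩
            simp only [Cfg.push] at p1 p2 ⊢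
            omega
          · rw [if_neg h0] at hrep'
            -- As the merging case is excluded, a head without label lies in the last segment, above
            -- every segment start.
            have hdrop := hinv.dropArc hrem hu hiu h0 (fun hcw j hj1 hj2 _ => by
              have h1 : c.bnd c.b ≤ c.idx w := by
                by_contra h1
                exact hc ⟨hcw, h0, by omega⟩
              rcases hj2.eq_or_lt with e | e
              · rwa [e]
              · exact (hinv.bnd_lt j c.b hj1 e le_rfl).le.trans h1)
            have p2 := Cfg.pot_dropArc hu hrem
            exact ⟨_, 0, p2.le, Runs.mono (Runs.cond_false ht (Runs.cond_true ht'
              (Runs.of_loopFree rfl ⟨_, hrep', hdrop, rfl⟩))) (by decide) fun _ h => h⟩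
    · have ht' : hasPath.eval τ = false := by
        rw [← Bool.not_eq_true, hpath]; exact hp
      -- The length of the removed segment is `d`: the potential falls by `d` through `s` and by one
      -- through `b`, which pays for a labelling loop of `d` rounds.
      refine ⟨c.pot n - (c.s - (c.bnd c.b - 1) + 1), c.s - (c.bnd c.b - 1), ?_, ?_⟩
      · simp only [Cfg.pot]; omega
      · refine Runs.mono (Runs.cond_false ht (Runs.cond_false ht' (hrep.pop hT1 hT2))) ?_ ?_
        · simp only [Test.cost, Expr.cost, hasPath]; omega
        · rintro τ' ⟨comp', h1, h2, h3⟩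
          refine ⟨_, h3, hinv.popSegment hR (by omega) (fun h4 => ?_) h1 h2, ?_⟩
          · by_contra h5
            exact hp ⟨h4, by omega⟩
          · simp only [Cfg.pot]; omega

theorem search_spec {R : ℕ → ℕ → Prop} (hR : ∀ u w, R u w → u < n ∧ w < n) {rem : ℕ → List ℕ}
    (hn : τ.reg .n = n) (hidx : ∀ u < n, τ.arr aIdx u = 0) (hcomp : ∀ u < n, τ.arr .comp u = 0)
    (hrem : ∀ u < n, ∀ w, w ∈ rem u ↔ R u w) (hlists : τ.HasLists n rem) :
    Runs search τ (100 * (5 * n + ∑ u ∈ Finset.range n, (rem u).length + 1)) fun τ' =>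
      ∀ u < n, ∀ w < n, (τ'.arr .comp u = τ'.arr .comp w ↔
        ReflTransGen R u w ∧ ReflTransGen R w u) := by
  refine Runs.mono (Runs.seq (Runs.of_loopFree rfl (Runs.loop (K := 90)
    -- The initial potential: n vertices to scan, 4 units for each of the n undiscovered vertices,
    -- and the lengths of the lists.
    (fun φ τ' h hb => searchStep_spec hR φ h hb) (5 * n + ∑ u ∈ Finset.range n, (rem u).length) _
    ⟨⟨0, 0, 0, 0, 0, τ.arr aIdx, τ.arr .comp, τ.arr aStk, τ.arr aBnd, τ.arr aPth, rem⟩, ?_,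
      Cfg.Inv.start hR hidx hcomp hrem, ?_⟩))) ?_ ?_
  · constructor <;> simp_all [Cmd.run, Expr.eval, State.HasLists]
  · have : (Finset.range n).filter (fun u => τ.arr aIdx u = 0) = Finset.range n :=
      Finset.filter_true_of_mem fun u hu => hidx u (by simpa using hu)
    simp only [Cfg.pot, this, Finset.card_range]; omega
  · simp only [Cmd.maxCost, Expr.cost, searchTest, Test.cost]; omega
  · rintro τ' ⟨hb, φ, c, hrep, hinv, -⟩
    have : c.s = 0 ∧ n ≤ c.v := by
      have e1 := hrep.s_eq
      have e2 := hrep.v_eq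
      have e3 := hrep.n_eq
      simp_all [searchTest, Test.eval, Expr.eval]
    rw [hrep.comp_eq]
    exact hinv.final this.1 this.2

end

/-- Add an arc from `s` to `t` to the adjacency lists. -/
def addArc (s t : Expr) : Cmd :=
  incr rK ;; .store aTgt (.reg rK) t ;; .store aNxt (.reg rK) (.get aHead s) ;;
    .store aHead s (.reg rK)

/-- The current edge is an edge of `G ∖ {x}`. -/
def isPresent : Test :=
  .and (.not (.eq (.get .alive (.reg .e)) (.const 0)))
    (.and (.not (.eq curSrc (.reg .x))) (.not (.eq curDst (.reg .x))))

/-- Empty adjacency lists, no vertex discovered. -/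
def initVerts : Cmd :=
  forLoop rV .n (.store aHead (.reg rV) (.const 0) ;; .store aIdx (.reg rV) (.const 0) ;;
    .store .comp (.reg rV) (.const 0))

/-- Build the adjacency lists by carrying out `body` for the edges of `G ∖ {x}`, and compute the
strongly connected components of the graph given by them. -/
def components (body : Cmd) : Cmd :=
  .assign rK (.const 0) ;; initVerts ;; forLoop .e .m (.cond isPresent body .skip) ;; search

/-- The subroutine for strongly connected components. -/
def sccCmd : Cmd := components (addArc curSrc curDst)

/-- The connected components of the undirected version of `G ∖ {x}`. -/
def weakComponents : Cmd := components (addArc curSrc curDst ;; addArc curDst curSrc)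

/-! ### Adjacency lists in memory, strong and weak components of `G ∖ {x}` -/

section

variable {n : ℕ} {τ : State} {rem : ℕ → List ℕ}

/-- The quantification over `τ'` says that `s` and `t` depend only on the current edge, so the
writes made on the way do not change their values. -/
theorem State.HasLists.addArc (h : τ.HasLists n rem) {s t : Expr} {u w : ℕ} (hu : u < n)
    (hs : ∀ τ' : State, τ'.reg .e = τ.reg .e → τ'.arr .src = τ.arr .src →
      τ'.arr .dst = τ.arr .dst → s.eval τ' = u)
    (ht : ∀ τ' : State, τ'.reg .e = τ.reg .e → τ'.arr .src = τ.arr .src →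
      τ'.arr .dst = τ.arr .dst → t.eval τ' = w) :
    ((ErSv.addArc s t).run τ).HasLists n (Function.update rem u (w :: rem u)) := by
  have h1 : (ErSv.addArc s t).run τ =
      (((τ.setReg rK (τ.reg rK + 1)).setArr aTgt (τ.reg rK + 1) w).setArr aNxt (τ.reg rK + 1)
        (τ.arr aHead u)).setArr aHead u (τ.reg rK + 1) := by
    simp only [ErSv.addArc, incr, Cmd.run, Expr.eval]
    simp only [State.setArr_reg, State.setArr_arr, State.setReg_reg, State.setReg_arr, if_true]
    rw [ht, hs, hs] <;> simp
  rw [h1]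
  intro u' hu'
  by_cases e : u' = u
  · subst e
    have := (h u' hu').extend (τ.arr aHead u') w
    simpa [Chain] using this
  · have := (h u' hu').extend (τ.arr aHead u) w
    simpa [Chain, e] using this

theorem sum_length_update {u w : ℕ} (hu : u < n) :
    ∑ v ∈ Finset.range n, (Function.update rem u (w :: rem u) v).length =
      ∑ v ∈ Finset.range n, (rem v).length + 1 := by
  have hmem : u ∈ Finset.range n := by simpa using hu
  have h1 := Finset.sum_erase_add (Finset.range n) (fun u => (rem u).length) hmem
  have h2 := Finset.sum_erase_add (Finset.range n)
    (fun v => (Function.update rem u (w :: rem u) v).length) hmem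
  have h3 : ∑ v ∈ (Finset.range n).erase u, (Function.update rem u (w :: rem u) v).length =
      ∑ v ∈ (Finset.range n).erase u, (rem v).length :=
    Finset.sum_congr rfl fun x hx => by rw [Function.update_of_ne (Finset.ne_of_mem_erase hx)]
  simp only [Function.update_self, List.length_cons] at h1 h2
  omega

theorem mem_update_cons {u w u' w' : ℕ} :
    w' ∈ Function.update rem u (w :: rem u) u' ↔ w' ∈ rem u' ∨ (u' = u ∧ w' = w) := by
  by_cases e : u' = u
  · subst e; simp [or_comm]
  · simp [e]

/-- The edge number `e` is an edge of `G ∖ {x}` from `u` to `w`. -/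
def State.EdgeAt (σ : State) (e u w : ℕ) : Prop :=
  σ.arr .alive e ≠ 0 ∧ u ≠ σ.reg .x ∧ w ≠ σ.reg .x ∧ σ.arr .src e = u ∧ σ.arr .dst e = w

theorem isPresent_iff : isPresent.eval τ = true ↔
    τ.EdgeAt (τ.reg .e) (τ.arr .src (τ.reg .e)) (τ.arr .dst (τ.reg .e)) := by
  simp only [isPresent, Test.eval, Bool.and_eq_true, Bool.not_eq_true', decide_eq_false_iff_not]
  simp only [Expr.eval, curSrc, curDst, State.EdgeAt, and_true, ne_eq]

theorem State.EdgeAt.congr {σ : State} (h1 : τ.arr .alive = σ.arr .alive)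
    (h2 : τ.reg .x = σ.reg .x) (h3 : τ.arr .src = σ.arr .src) (h4 : τ.arr .dst = σ.arr .dst)
    (e u w : ℕ) : τ.EdgeAt e u w ↔ σ.EdgeAt e u w := by
  simp only [State.EdgeAt, h1, h2, h3, h4]

/-- The main program's variables, except for the loop variable `e`, keep their contents. -/
structure State.SameMain (σ τ : State) : Prop where
  n_eq : τ.reg .n = σ.reg .n
  m_eq : τ.reg .m = σ.reg .m
  x_eq : τ.reg .x = σ.reg .x
  src_eq : τ.arr .src = σ.arr .src
  dst_eq : τ.arr .dst = σ.arr .dst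
  alive_eq : τ.arr .alive = σ.arr .alive

/-- One statement serves both subroutines: `A i u w u' w'` means that the edge number `i` from `u`
to `w` contributes the arc from `u'` to `w'`. The weak version inserts two arcs per edge, hence the
2 in the length bound. -/
theorem components_spec {body : Cmd} (hfree : body.loopFree = true)
    (hreg : ∀ r, r = .n ∨ r = .m ∨ r = .x ∨ r = .e → body.keepsReg r = true)
    (harr : ∀ a, a = .src ∨ a = .dst ∨ a = .alive ∨ a = aIdx ∨ a = .comp → body.keepsArr a = true)
    {A : ℕ → ℕ → ℕ → ℕ → ℕ → Prop}
    (hA : ∀ i u w u' w', u < n → w < n → A i u w u' w' → u' < n ∧ w' < n)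
    (hbody : ∀ (τ : State) (rem : ℕ → List ℕ), τ.HasLists n rem →
      τ.arr .src (τ.reg .e) < n → τ.arr .dst (τ.reg .e) < n →
      ∃ rem', (body.run τ).HasLists n rem' ∧
        (∀ u w, w ∈ rem' u ↔ w ∈ rem u ∨
          A (τ.reg .e) (τ.arr .src (τ.reg .e)) (τ.arr .dst (τ.reg .e)) u w) ∧
        ∑ u ∈ Finset.range n, (rem' u).length ≤ ∑ u ∈ Finset.range n, (rem u).length + 2)
    {σ : State} (hσ : σ.Valid n) :
    Runs (components body) σ ((700 + body.maxCost) * (n + σ.reg .m + 1)) fun τ =>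
      ∀ u < n, ∀ w < n, (τ.arr .comp u = τ.arr .comp w ↔
        ReflTransGen (fun u' w' => ∃ i < σ.reg .m, ∃ u w, σ.EdgeAt i u w ∧ A i u w u' w') u w ∧
        ReflTransGen (fun u' w' => ∃ i < σ.reg .m, ∃ u w, σ.EdgeAt i u w ∧ A i u w u' w') w u) := by
  obtain ⟨hn, hval⟩ := hσ
  set M := σ.reg .m with hM
  refine Runs.mono (Runs.seq (Runs.of_loopFree rfl (Runs.seq
    (Q := fun τ => ∀ u < n, ∀ w < n, (τ.arr .comp u = τ.arr .comp w ↔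
        ReflTransGen (fun u' w' => ∃ i < M, ∃ u w, σ.EdgeAt i u w ∧ A i u w u' w') u w ∧
        ReflTransGen (fun u' w' => ∃ i < M, ∃ u w, σ.EdgeAt i u w ∧ A i u w u' w') w u))
    (K₂ := (20 + body.maxCost + 6) * M + 5 + 100 * (5 * n + 2 * M + 1))
    (Runs.mono (Runs.forLoop (N := n) (K := 9)
      (I := fun i τ => σ.SameMain τ ∧ τ.reg rK = 0 ∧
        ∀ u < i, τ.arr aHead u = 0 ∧ τ.arr aIdx u = 0 ∧ τ.arr .comp u = 0)
      (by decide) ?_ ?_ ?_) le_rfl ?_)))) ?_ fun τ h => h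
  · simpa [Cmd.run] using hn
  · refine ⟨by constructor <;> simp [Cmd.run], by simp [Cmd.run, Expr.eval], by omega⟩
  · rintro i hi τ h1 h2 ⟨⟨h3, h4, h5, h6, h7, h8⟩, h9, h10⟩
    refine Runs.mono (Runs.of_loopFree rfl ?_) (show _ ≤ 9 by decide) fun _ h => h
    refine ⟨by simpa [Cmd.run] using h1, by simpa [Cmd.run] using h2, ⟨?_, ?_, ?_⟩⟩
    · constructor <;> simpa [Cmd.run]
    · simpa [Cmd.run] using h9
    · intro u hu
      have := h10 u
      simp only [rV] at h1
      simp only [Cmd.run, Expr.eval, rV, aHead, aIdx, h1, State.setArr_arr, State.setArr_reg,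
        State.setReg_arr, Arr.tmp.injEq, reduceCtorEq, if_false, if_true, OfNat.ofNat_ne_zero,
        OfNat.zero_ne_ofNat, Function.update_apply]
      grind
  · rintro τ₀ ⟨hmain, hK, hz⟩
    have hvalid : ∀ i < M, σ.arr .src i < n ∧ σ.arr .dst i < n := hval
    refine Runs.seq (Runs.mono (Runs.forLoop (N := M) (K := 20 + body.maxCost)
      (I := fun i τ => σ.SameMain τ ∧ (∀ u < n, τ.arr aIdx u = 0 ∧ τ.arr .comp u = 0) ∧
        ∃ rem, τ.HasLists n rem ∧ (∀ u < n, ∀ w, w ∈ rem u ↔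
            ∃ j < i, ∃ u' w', σ.EdgeAt j u' w' ∧ A j u' w' u w) ∧
          ∑ u ∈ Finset.range n, (rem u).length ≤ 2 * i)
      (by decide) ?_ ?_ ?_) le_rfl ?_)
    · rw [hmain.m_eq]
    · obtain ⟨h3, h4, h5, h6, h7, h8⟩ := hmain
      refine ⟨by constructor <;> simpa, fun u hu => by simpa using (hz u hu).2, fun _ => [], ?_,
        by simp, by simp⟩
      intro u hu
      simpa [Chain] using (hz u hu).1
    · rintro i hi τ h1 h2 ⟨hmain', hz', rem, hl, hmem, hsum⟩
      have hedge := State.EdgeAt.congr hmain'.alive_eq hmain'.x_eq hmain'.src_eq hmain'.dst_eq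
      obtain ⟨hs, hd⟩ := hvalid i hi
      rw [← hmain'.src_eq] at hs
      rw [← hmain'.dst_eq] at hd
      -- Shared by both branches of the conditional: incrementing `e` disturbs no clause of the
      -- invariant.
      have hfin : ∀ τ' : State, ∀ rem', σ.SameMain τ' → τ'.reg .e = i →
          (∀ u < n, τ'.arr aIdx u = 0 ∧ τ'.arr .comp u = 0) →
          τ'.HasLists n rem' → (∀ u < n, ∀ w, w ∈ rem' u ↔
            ∃ j < i + 1, ∃ u' w', σ.EdgeAt j u' w' ∧ A j u' w' u w) →
          ∑ u ∈ Finset.range n, (rem' u).length ≤ 2 * (i + 1) →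
          τ'.reg .e = i ∧ τ'.reg .m = M ∧ σ.SameMain (τ'.setReg .e (i + 1)) ∧
          (∀ u < n, (τ'.setReg .e (i + 1)).arr aIdx u = 0 ∧
            (τ'.setReg .e (i + 1)).arr .comp u = 0) ∧
          ∃ rem, (τ'.setReg .e (i + 1)).HasLists n rem ∧ (∀ u < n, ∀ w, w ∈ rem u ↔
            ∃ j < i + 1, ∃ u' w', σ.EdgeAt j u' w' ∧ A j u' w' u w) ∧
          ∑ u ∈ Finset.range n, (rem u).length ≤ 2 * (i + 1) := by
        rintro τ' rem' ⟨h3, h4, h5, h6, h7, h8⟩ h9 h10 h11 h12 h13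
        exact ⟨h9, h4, by constructor <;> simpa, by simpa using h10, rem',
          by simpa [State.HasLists] using h11, h12, h13⟩
      refine Runs.mono (Runs.cond (K := body.maxCost + 1) (fun hb => ?_) (fun hb => ?_)) ?_
        fun _ h => h
      · rw [isPresent_iff, h1, hedge] at hb
        obtain ⟨rem', h3, h4, h5⟩ := hbody τ rem hl (by rwa [h1]) (by rwa [h1])
        rw [h1] at h4
        refine Runs.mono (Runs.frame (Runs.of_loopFree hfree
          (Q := fun τ' => τ'.HasLists n rem') h3)) (by omega) ?_
        rintro τ' ⟨h6, hr, ha⟩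
        replace hr := fun r h => hr r (hreg r h)
        replace ha := fun a h => ha a (harr a h)
        refine hfin τ' rem' ⟨?_, ?_, ?_, ?_, ?_, ?_⟩ ?_ ?_ h6 ?_ (by omega)
        · rw [hr _ (by simp), hmain'.n_eq]
        · rw [hr _ (by simp), hmain'.m_eq]
        · rw [hr _ (by simp), hmain'.x_eq]
        · rw [ha _ (by simp), hmain'.src_eq]
        · rw [ha _ (by simp), hmain'.dst_eq]
        · rw [ha _ (by simp), hmain'.alive_eq]
        · rw [hr _ (by simp), h1]
        · rw [ha _ (by simp), ha _ (by simp)]; exact hz'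
        · intro u hu w
          rw [h4, hmem u hu]
          constructor
          · rintro (⟨j, hj, h⟩ | h)
            · exact ⟨j, by omega, h⟩
            · exact ⟨i, by omega, _, _, hb, h⟩
          · rintro ⟨j, hj, u', w', hE, h⟩
            rcases Nat.lt_succ_iff_lt_or_eq.mp hj with h7 | rfl
            · exact .inl ⟨j, h7, u', w', hE, h⟩
            · right
              rw [← hedge] at hE
              obtain ⟨-, -, -, rfl, rfl⟩ := hE
              exact h
      · rw [← Bool.not_eq_true, isPresent_iff, h1, hedge] at hb
        refine Runs.mono (Runs.of_loopFree rfl ?_) (show 1 ≤ _ by omega) fun _ h => h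
        refine hfin τ rem hmain' h1 hz' hl (fun u hu w => ?_) (by omega)
        rw [hmem u hu]
        constructor
        · rintro ⟨j, hj, h⟩
          exact ⟨j, by omega, h⟩
        · rintro ⟨j, hj, u', w', hE, h⟩
          rcases Nat.lt_succ_iff_lt_or_eq.mp hj with h7 | rfl
          · exact ⟨j, h7, u', w', hE, h⟩
          · refine absurd ?_ hb
            have hE' := hE
            rw [← hedge] at hE'
            obtain ⟨-, -, -, e1, e2⟩ := hE'
            rw [e1, e2]
            exact hE
      · simp only [isPresent, Test.cost, Expr.cost, curSrc, curDst]; omega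
    · rintro τ ⟨hmain', hz', rem, hl, hmem, hsum⟩
      refine Runs.mono (search_spec (R := fun u' w' => ∃ i < M, ∃ u w, σ.EdgeAt i u w ∧
        A i u w u' w') ?_ (by rw [hmain'.n_eq, hn]) (fun u hu => (hz' u hu).1)
        (fun u hu => (hz' u hu).2) hmem hl) (by omega) fun _ h => h
      rintro u' w' ⟨i, hi, u, w, ⟨-, -, -, h1, h2⟩, h3⟩
      obtain ⟨h4, h5⟩ := hvalid i hi
      exact hA i u w u' w' (h1 ▸ h4) (h2 ▸ h5) h3
  · simp only [Cmd.maxCost, Expr.cost]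
    ring_nf
    have : 0 ≤ body.maxCost * n := Nat.zero_le _
    omega

theorem sccCmd_spec {σ : State} (hσ : σ.Valid n) :
    Runs sccCmd σ (800 * (n + σ.reg .m + 1)) fun τ =>
      ∀ u < n, ∀ w < n, (τ.arr .comp u = τ.arr .comp w ↔
        ReflTransGen (fun u w => ∃ i < σ.reg .m, σ.EdgeAt i u w) u w ∧
        ReflTransGen (fun u w => ∃ i < σ.reg .m, σ.EdgeAt i u w) w u) := by
  have := components_spec (n := n) (body := addArc curSrc curDst) rfl
    (by rintro r (rfl | rfl | rfl | rfl) <;> rfl) (by rintro r (rfl | rfl | rfl | rfl | rfl) <;> rfl)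
    (A := fun _ u w u' w' => u' = u ∧ w' = w) (by rintro i u w u' w' h1 h2 ⟨rfl, rfl⟩; exact ⟨h1, h2⟩)
    (fun τ rem hl hs hd => ⟨_, hl.addArc hs (fun τ' h1 h2 h3 => by simp [curSrc, Expr.eval, h1, h2])
      (fun τ' h1 h2 h3 => by simp [curDst, Expr.eval, h1, h3]), fun u w => mem_update_cons,
      by rw [sum_length_update hs]; omega⟩) hσ
  refine this.mono (Nat.mul_le_mul_right _ (by decide)) fun τ h => ?_
  have e : (fun u' w' => ∃ i < σ.reg .m, ∃ u w, σ.EdgeAt i u w ∧ u' = u ∧ w' = w) =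
      fun u w => ∃ i < σ.reg .m, σ.EdgeAt i u w := by
    ext u w; simp
  rwa [e] at h

theorem weakComponents_spec {σ : State} (hσ : σ.Valid n) :
    Runs weakComponents σ (800 * (n + σ.reg .m + 1)) fun τ =>
      ∀ u < n, ∀ w < n, (τ.arr .comp u = τ.arr .comp w ↔
        ReflTransGen (fun u w => ∃ i < σ.reg .m, σ.EdgeAt i u w ∨ σ.EdgeAt i w u) u w) := by
  have := components_spec (n := n) (body := addArc curSrc curDst ;; addArc curDst curSrc) rfl
    (by rintro r (rfl | rfl | rfl | rfl) <;> rfl) (by rintro r (rfl | rfl | rfl | rfl | rfl) <;> rfl)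
    (A := fun _ u w u' w' => (u' = u ∧ w' = w) ∨ (u' = w ∧ w' = u))
    (by rintro i u w u' w' h1 h2 (⟨rfl, rfl⟩ | ⟨rfl, rfl⟩) <;> exact ⟨by assumption, by assumption⟩)
    (fun τ rem hl hs hd => by
      have h1 := hl.addArc (s := curSrc) (t := curDst) (w := τ.arr .dst (τ.reg .e)) hs
        (fun τ' h1 h2 h3 => by simp [curSrc, Expr.eval, h1, h2])
        (fun τ' h1 h2 h3 => by simp [curDst, Expr.eval, h1, h3])
      have e1 : ((addArc curSrc curDst).run τ).reg .e = τ.reg .e := by simp [addArc, incr, Cmd.run]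
      have e2 : ((addArc curSrc curDst).run τ).arr .src = τ.arr .src := by
        simp [addArc, incr, Cmd.run]
      have e3 : ((addArc curSrc curDst).run τ).arr .dst = τ.arr .dst := by
        simp [addArc, incr, Cmd.run]
      have h2 := h1.addArc (s := curDst) (t := curSrc) hd
        (fun τ' h1 h2 h3 => by rw [e1] at h1; rw [e3] at h3; simp [curDst, Expr.eval, h1, h3])
        (w := τ.arr .src (τ.reg .e))
        (fun τ' h1 h2 h3 => by rw [e1] at h1; rw [e2] at h2; simp [curSrc, Expr.eval, h1, h2])
      refine ⟨_, h2, fun u w => ?_, ?_⟩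
      · rw [mem_update_cons, mem_update_cons, or_assoc]
      · rw [sum_length_update hd, sum_length_update hs]) hσ
  refine this.mono (Nat.mul_le_mul_right _ (by decide)) fun τ h => ?_
  have e : (fun u' w' => ∃ i < σ.reg .m, ∃ u w, σ.EdgeAt i u w ∧
      ((u' = u ∧ w' = w) ∨ (u' = w ∧ w' = u))) =
      fun u w => ∃ i < σ.reg .m, σ.EdgeAt i u w ∨ σ.EdgeAt i w u := by
    ext u' w'
    constructor
    · rintro ⟨i, hi, u, w, hE, ⟨rfl, rfl⟩ | ⟨rfl, rfl⟩⟩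
      exacts [⟨i, hi, .inl hE⟩, ⟨i, hi, .inr hE⟩]
    · rintro ⟨i, hi, hE | hE⟩
      exacts [⟨i, hi, _, _, hE, .inl ⟨rfl, rfl⟩⟩, ⟨i, hi, _, _, hE, .inr ⟨rfl, rfl⟩⟩]
  rw [e] at h
  intro u hu w hw
  rw [h u hu w hw]
  -- The relation is symmetric, so a path can be reversed and strong components are connected
  -- components.
  refine ⟨fun h => h.1, fun h => ⟨h, ?_⟩⟩
  exact ReflTransGen.mono (fun _ _ ⟨i, hi, h⟩ => ⟨i, hi, h.symm⟩) _ _ h.swap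

end

/-- Reachability in `G ∖ {x}`, expressed by the edges in memory. -/
theorem reach_deleteVerts {n : ℕ} {σ : State} (hσ : σ.Valid n)
    (u w : {v : Fin n // v ∉ {v : Fin n | (v : ℕ) = σ.reg .x}}) :
    ReflTransGen (deleteVerts (σ.graph n) _).Adj u w ↔
      ReflTransGen (fun u w => ∃ i < σ.reg .m, σ.EdgeAt i u w) (u.1 : ℕ) (w.1 : ℕ) := by
  constructor
  · intro h
    refine ReflTransGen.lift
      (fun v : {v : Fin n // v ∉ {v : Fin n | (v : ℕ) = σ.reg .x}} => (v.1 : ℕ)) ?_ _ _ h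
    rintro a b ⟨e, he, h1, h2, h3⟩
    exact ⟨e, he, h1, a.2, b.2, h2, h3⟩
  · intro h
    -- `EdgeAt` keeps both ends away from `x`, and validity keeps them below `n`, so every number
    -- reached is a vertex of the smaller graph.
    have key : ∀ z : ℕ, ReflTransGen (fun u w => ∃ i < σ.reg .m, σ.EdgeAt i u w) (u.1 : ℕ) z →
        ∃ z' : {v : Fin n // v ∉ {v : Fin n | (v : ℕ) = σ.reg .x}}, (z'.1 : ℕ) = z ∧
          ReflTransGen (deleteVerts (σ.graph n) _).Adj u z' := by
      intro z hz
      induction hz with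
      | refl => exact ⟨u, rfl, .refl⟩
      | tail _ h ih =>
        obtain ⟨z', rfl, h1⟩ := ih
        obtain ⟨i, hi, h2, h3, h4, h5, h6⟩ := h
        exact ⟨⟨⟨_, h6 ▸ (hσ.2 i hi).2⟩, h4⟩, rfl, h1.tail ⟨i, hi, h2, h5, h6⟩⟩
    obtain ⟨z', h1, h2⟩ := key _ h
    have : z' = w := Subtype.ext (Fin.ext h1)
    rwa [this] at h2

theorem sccCmd_computesSCC : ComputesSCC sccCmd := by
  intro n σ hσ
  obtain ⟨σ', t, he, -, h⟩ := sccCmd_spec hσ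
  refine ⟨σ', t, he, ⟨he.reg_eq rfl, he.reg_eq rfl, he.arr_eq rfl, he.arr_eq rfl, he.arr_eq rfl⟩,
    he.reg_eq rfl, he.reg_eq rfl, fun u w => ?_⟩
  rw [h _ u.1.2 _ w.1.2, SameSCC, reach_deleteVerts hσ, reach_deleteVerts hσ]

/-! ### Two-connected components -/

section

variable {V : Type*} {H : SimpleGraph V}

open Classical in
/-- The vertices that no single other vertex separates from the edge `a b` of `H`. -/
def blockOf (H : SimpleGraph V) (a b : V) : Set V :=
  {z | ∀ x, x ≠ z → ∃ p : H.Walk z (if a = x then b else a), x ∉ p.support}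

theorem left_mem_blockOf (a b : V) : a ∈ blockOf H a b := by
  intro x hx
  rw [if_neg hx.symm]
  exact ⟨.nil, by simpa using hx⟩

theorem right_mem_blockOf {a b : V} (h : H.Adj a b) : b ∈ blockOf H a b := by
  intro x hx
  by_cases hax : a = x
  · rw [if_pos hax]
    exact ⟨.nil, by simpa using hx⟩
  · rw [if_neg hax]
    exact ⟨.cons h.symm .nil, by simpa using ⟨hx, fun e => hax e.symm⟩⟩

/-- A path that avoids `x` from a vertex of `blockOf H a b` to `a` or `b` stays in it. -/
theorem mem_blockOf_of_isPath {a b : V} (hab : H.Adj a b) {z r : V} (hz : z ∈ blockOf H a b)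
    (hr : r = a ∨ r = b) (p : H.Walk z r) (hp : p.IsPath) {y : V} (hy : y ∈ p.support) :
    y ∈ blockOf H a b := by
  classical
  intro w hw
  -- If `w` lies on the part of the path after `y`, it does not lie on the part before: go back to
  -- `z` and use a walk from there that avoids `w`. Otherwise go on to `r`, and cross the edge `a b`
  -- if needed.
  by_cases hwd : w ∈ (p.dropUntil y hy).support
  · have hwt : w ∉ (p.takeUntil y hy).support := by
      intro hwt
      have hspec := p.take_spec hy
      rw [← hspec, SimpleGraph.Walk.isPath_def, SimpleGraph.Walk.support_append] at hp
      have hdis := (List.nodup_append.1 hp).2.2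
      have : w ∈ (p.dropUntil y hy).support.tail := by
        have h1 := SimpleGraph.Walk.mem_support_iff (p.dropUntil y hy) |>.1 hwd
        exact h1.resolve_left hw
      exact hdis _ hwt _ this rfl
    have hwz : w ≠ z := by
      rintro rfl
      exact hwt (SimpleGraph.Walk.start_mem_support _)
    obtain ⟨q, hq⟩ := hz w hwz
    refine ⟨(p.takeUntil y hy).reverse.append q, ?_⟩
    simp only [SimpleGraph.Walk.mem_support_append_iff, SimpleGraph.Walk.support_reverse,
      List.mem_reverse]
    tauto
  · have hwr : w ≠ r := by
      rintro rfl
      exact hwd (SimpleGraph.Walk.end_mem_support _)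
    have hq : ∃ q : H.Walk r (if a = w then b else a), w ∉ q.support := by
      rcases hr with rfl | rfl
      · exact left_mem_blockOf r b w hwr
      · exact right_mem_blockOf hab w hwr
    obtain ⟨q, hq⟩ := hq
    refine ⟨(p.dropUntil y hy).append q, ?_⟩
    simp only [SimpleGraph.Walk.mem_support_append_iff]
    tauto

/-- The walk that `blockOf` provides is shortened to a path, which stays in the block and hence in
`S`. -/
theorem reachable_induce_blockOf {a b : V} (hab : H.Adj a b) {z x : V} (hz : z ∈ blockOf H a b)
    (hx : x ≠ z) {S : Set V} (hS : ∀ y ∈ blockOf H a b, y ≠ x → y ∈ S) :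
    ∃ r, ∃ hr : r ∈ S, ∃ hzS : z ∈ S, (a ≠ x → r = a) ∧ (a = x → r = b) ∧
      (H.induce S).Reachable ⟨z, hzS⟩ ⟨r, hr⟩ := by
  classical
  obtain ⟨p, hp⟩ := hz x hx
  have hp' : x ∉ p.bypass.support := fun h => hp (p.support_bypass_subset_support h)
  have hsub : ∀ y ∈ p.bypass.support, y ∈ S := fun y hy =>
    hS y (mem_blockOf_of_isPath hab hz (by split <;> simp) _ p.bypass_isPath hy)
      (by rintro rfl; exact hp' hy)
  refine ⟨_, hsub _ (SimpleGraph.Walk.end_mem_support _),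
    hsub _ (SimpleGraph.Walk.start_mem_support _), fun h => if_neg h, fun h => if_pos h,
    ⟨p.bypass.induce S hsub⟩⟩

theorem isVertexConnectedOn_blockOf {a b : V} (hab : H.Adj a b)
    (hcard : 3 ≤ (blockOf H a b).ncard) : IsVertexConnectedOn H 2 (blockOf H a b) := by
  classical
  refine ⟨hcard, fun X hX hX2 => ?_⟩
  have hfin : (blockOf H a b).Finite := Set.finite_of_ncard_pos (by omega)
  have hXfin := hfin.subset hX
  suffices hs : ∃ r, ∃ hr : r ∈ blockOf H a b \ X, ∀ z, ∀ hz : z ∈ blockOf H a b \ X,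
      (H.induce (blockOf H a b \ X)).Reachable ⟨z, hz⟩ ⟨r, hr⟩ by
    obtain ⟨r, hr, h⟩ := hs
    have : Nonempty ↑(blockOf H a b \ X) := ⟨⟨r, hr⟩⟩
    exact ⟨fun u w => (h u.1 u.2).trans (h w.1 w.2).symm⟩
  obtain h0 | h1 : X.ncard = 0 ∨ X.ncard = 1 := by omega
  · rw [Set.ncard_eq_zero hXfin] at h0
    subst h0
    -- Nothing is deleted, but `blockOf` speaks of walks that avoid some vertex. Avoiding `a` leads
    -- every other vertex to `b`, and `a` is adjacent to `b`.
    have hb : b ∈ blockOf H a b \ ∅ := ⟨right_mem_blockOf hab, by simp⟩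
    refine ⟨b, hb, fun z hz => ?_⟩
    by_cases hza : a = z
    · subst hza
      exact SimpleGraph.Adj.reachable (by simpa using hab)
    · obtain ⟨r, hr, hz', -, h, hreach⟩ := reachable_induce_blockOf hab hz.1 hza
        (S := blockOf H a b \ ∅) (fun y hy _ => ⟨hy, by simp⟩)
      obtain rfl := h rfl
      exact hreach
  · obtain ⟨x, rfl⟩ := Set.ncard_eq_one.1 h1
    have hr : (if a = x then b else a) ∈ blockOf H a b \ {x} := by
      split
      · rename_i e
        exact ⟨right_mem_blockOf hab, by rintro rfl; exact hab.ne e⟩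
      · rename_i e
        exact ⟨left_mem_blockOf a b, e⟩
    refine ⟨_, hr, fun z hz => ?_⟩
    obtain ⟨r, hr', hz', h2, h3, hreach⟩ := reachable_induce_blockOf hab hz.1
      (fun e => hz.2 e.symm) (S := blockOf H a b \ {x}) (fun y hy hyx => ⟨hy, hyx⟩)
    obtain rfl : r = if a = x then b else a := by
      split
      · exact h3 ‹_›
      · exact h2 ‹_›
    exact hreach

/-- After the deletion of `x`, which may lie outside `D`, the set stays connected, so each other
vertex of `D` is joined inside it to an end that survives. This gives both maximality and uniqueness
of blocks. -/
theorem subset_blockOf {a b : V} (hab : a ≠ b) {D : Set V} (hD : IsVertexConnectedOn H 2 D)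
    (ha : a ∈ D) (hb : b ∈ D) : D ⊆ blockOf H a b := by
  classical
  intro z hz x hx
  have hcard : ({x} ∩ D : Set V).ncard < 2 := by
    have := Set.ncard_le_ncard (Set.inter_subset_left : {x} ∩ D ⊆ {x}) (Set.finite_singleton x)
    rw [Set.ncard_singleton] at this
    omega
  have hconn := hD.2 ({x} ∩ D) Set.inter_subset_right hcard
  have hmem : ∀ y ∈ D, y ≠ x → y ∈ D \ ({x} ∩ D) := fun y hy hyx => ⟨hy, fun h => hyx h.1⟩
  have hr : (if a = x then b else a) ∈ D \ ({x} ∩ D) := by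
    split
    · rename_i e
      exact hmem b hb (by rintro rfl; exact hab e)
    · rename_i e
      exact hmem a ha e
  obtain ⟨p⟩ := hconn.preconnected ⟨z, hmem z hz hx.symm⟩ ⟨_, hr⟩
  let f : H.induce (D \ ({x} ∩ D)) →g H := (SimpleGraph.Embedding.induce _).toHom
  refine ⟨p.map f, fun h => ?_⟩
  replace h : x ∈ (p.map f).support := h
  rw [SimpleGraph.Walk.support_map, List.mem_map] at h
  obtain ⟨y, -, hy⟩ := h
  exact y.2.2 ⟨hy, y.2.1⟩

theorem blockOf_maximal [Finite V] {a b : V} (hab : H.Adj a b)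
    (hcard : 3 ≤ (blockOf H a b).ncard) : blockOf H a b ∈ twoConnectedComponents H :=
  ⟨isVertexConnectedOn_blockOf hab hcard, fun _ hD hsub =>
    subset_blockOf hab.ne hD (hsub (left_mem_blockOf a b)) (hsub (right_mem_blockOf hab))⟩

/-- A component is connected and has at least three vertices, so it contains an edge. It lies in the
block of this edge, and by maximality it is that block. -/
theorem mem_twoConnectedComponents [Finite V] {C : Set V} :
    C ∈ twoConnectedComponents H ↔ ∃ a b, H.Adj a b ∧ C = blockOf H a b ∧ 3 ≤ C.ncard := by
  constructor
  · intro hC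
    have hC1 : IsVertexConnectedOn H 2 C := hC.1
    obtain ⟨u, w, hu, hw, huw⟩ := (Set.one_lt_ncard_iff (Set.toFinite C)).1
      (lt_of_lt_of_le (by norm_num) hC1.1)
    obtain ⟨p⟩ := (hC1.2 ∅ (Set.empty_subset _) (by simp)).preconnected
      ⟨u, hu, by simp⟩ ⟨w, hw, by simp⟩
    cases p with
    | nil => exact absurd rfl huw
    | @cons _ v _ h q =>
      have hadj : H.Adj u v := h
      have hsub := subset_blockOf hadj.ne hC1 hu v.2.1
      have hcard : 3 ≤ (blockOf H u v).ncard :=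
        le_trans hC1.1 (Set.ncard_le_ncard hsub (Set.toFinite _))
      exact ⟨u, v, hadj, hsub.antisymm (hC.2 (isVertexConnectedOn_blockOf hadj hcard) hsub),
        hC1.1⟩
  · rintro ⟨a, b, hab, rfl, hcard⟩
    exact blockOf_maximal hab hcard

/-- Hence each edge inside a component determines it, which lets the program recognise components
already listed. -/
theorem blockOf_eq [Finite V] {a b c d : V} (hab : H.Adj a b) (hcd : H.Adj c d)
    (hcard : 3 ≤ (blockOf H a b).ncard) (hc : c ∈ blockOf H a b) (hd : d ∈ blockOf H a b) :
    blockOf H c d = blockOf H a b := by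
  have hsub := subset_blockOf hcd.ne (isVertexConnectedOn_blockOf hab hcard) hc hd
  have hcard' : 3 ≤ (blockOf H c d).ncard :=
    hcard.trans (Set.ncard_le_ncard hsub (Set.toFinite _))
  exact ((blockOf_maximal hab hcard).2 (isVertexConnectedOn_blockOf hcd hcard') hsub).antisymm hsub

/-- In this form the size condition is tested by one sweep over the marks. -/
theorem three_le_ncard_blockOf [Finite V] {a b : V} (hab : H.Adj a b) :
    3 ≤ (blockOf H a b).ncard ↔ ∃ z ∈ blockOf H a b, z ≠ a ∧ z ≠ b := by
  constructor
  · intro h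
    by_contra! hcon
    have hsub : blockOf H a b ⊆ {a, b} := fun z hz => by
      by_cases e : z = a
      · exact .inl e
      · exact .inr (hcon z hz e)
    have := Set.ncard_le_ncard hsub (Set.toFinite _)
    rw [Set.ncard_pair hab.ne] at this
    omega
  · rintro ⟨z, hz, hza, hzb⟩
    have hsub : ({z, a, b} : Set V) ⊆ blockOf H a b := by
      rintro y (rfl | rfl | rfl)
      exacts [hz, left_mem_blockOf _ _, right_mem_blockOf hab]
    have h3 : ({z, a, b} : Set V).ncard = 3 :=
      Set.ncard_eq_three.2 ⟨z, a, b, hza, hzb, hab.ne, rfl⟩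
    exact h3 ▸ Set.ncard_le_ncard hsub (Set.toFinite _)

end

/-! ### The subroutine for 2-connected components -/

/-- The cells that the body never writes enter the invariant automatically, so `I` only has to
describe what changes. -/
theorem Runs.forLoop_frame {r bound : Reg} {c : Cmd} {I : ℕ → State → Prop} {N K : ℕ} {σ : State}
    (hr : r ≠ bound) (hN : σ.reg bound = N) (hkr : c.keepsReg r = true)
    (hkb : c.keepsReg bound = true) (h0 : I 0 (σ.setReg r 0))
    (hstep : ∀ i < N, ∀ τ, τ.reg r = i → (∀ r', r' ≠ r → c.keepsReg r' = true →
      τ.reg r' = σ.reg r') → (∀ a, c.keepsArr a = true → τ.arr a = σ.arr a) → I i τ →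
      Runs c τ K fun τ' => I (i + 1) (τ'.setReg r (i + 1))) :
    Runs (ErSv.forLoop r bound c) σ ((K + 6) * N + 5) (I N) := by
  refine Runs.mono (Runs.forLoop (I := fun i τ => I i τ ∧ (∀ r', r' ≠ r → c.keepsReg r' = true →
      τ.reg r' = σ.reg r') ∧ (∀ a, c.keepsArr a = true → τ.arr a = σ.arr a)) hr hN
    ⟨h0, fun r' hr' _ => by simp [hr'], fun a _ => rfl⟩ ?_) le_rfl fun _ h => h.1
  rintro i hi τ h1 h2 ⟨h3, h4, h5⟩
  refine (hstep i hi τ h1 h4 h5 h3).frame.mono le_rfl ?_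
  rintro τ' ⟨h6, h7, h8⟩
  exact ⟨(h7 r hkr).trans h1, (h7 bound hkb).trans h2, h6,
    fun r' hr' hk => by simp [hr', h7 r' hk, h4 r' hr' hk],
    fun a hk => by simp [h8 a hk, h5 a hk]⟩

/-- number of the edge under consideration -/
@[simp] abbrev rE : Reg := .tmp 10
/-- tail of the edge under consideration -/
@[simp] abbrev rA : Reg := .tmp 11
/-- head of the edge under consideration -/
@[simp] abbrev rD : Reg := .tmp 12
/-- loop variable running over the vertices -/
@[simp] abbrev rZ : Reg := .tmp 13
/-- an end of the edge under consideration that is not deleted -/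
@[simp] abbrev rR : Reg := .tmp 14
/-- flag: is there a new component? -/
@[simp] abbrev rOk : Reg := .tmp 15
/-- length of the output -/
@[simp] abbrev rPos : Reg := .tmp 16
/-- marks of the vertices that have not been separated from the edge under consideration -/
@[simp] abbrev aMark : Arr := .tmp 7

/-- Unmark the vertices that the vertex `x` separates from the edge under consideration. -/
def unmarkSeparated : Cmd :=
  weakComponents ;;
  .cond (.eq (.reg rA) (.reg .x)) (.assign rR (.reg rD)) (.assign rR (.reg rA)) ;;
  forLoop rZ .n
    (.cond (.and (.not (.eq (.reg rZ) (.reg .x)))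
        (.not (.eq (.get .comp (.reg rZ)) (.get .comp (.reg rR)))))
      (.store aMark (.reg rZ) (.const 0)) .skip)

/-- Mark the vertices that no single other vertex separates from the edge under consideration. -/
def markBlock : Cmd :=
  forLoop rZ .n (.store aMark (.reg rZ) (.const 1)) ;; forLoop .x .n unmarkSeparated

/-- Do the marked vertices form a 2-connected component that does not contain an edge considered
before? -/
def selectBlock : Cmd :=
  .assign rOk (.const 0) ;;
  forLoop rZ .n
    (.cond (.and (.not (.eq (.get aMark (.reg rZ)) (.const 0)))
        (.and (.not (.eq (.reg rZ) (.reg rA))) (.not (.eq (.reg rZ) (.reg rD)))))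
      (.assign rOk (.const 1)) .skip) ;;
  forLoop .e rE
    (.cond (.and (.not (.eq (.get .alive (.reg .e)) (.const 0))) (.and (.not (.eq curSrc curDst))
        (.and (.not (.eq (.get aMark curSrc) (.const 0)))
          (.not (.eq (.get aMark curDst) (.const 0))))))
      (.assign rOk (.const 0)) .skip)

/-- Output the marked vertices. -/
def emitBlock : Cmd :=
  forLoop rZ .n
    (.cond (.not (.eq (.get aMark (.reg rZ)) (.const 0)))
      (.store .outVert (.reg rPos) (.reg rZ) ;; incr rPos) .skip) ;;
  incr .count ;; .store .outStart (.reg .count) (.reg rPos)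

/-- Deal with the edge number `rE`. -/
def bccStep : Cmd :=
  .cond (.and (.not (.eq (.get .alive (.reg rE)) (.const 0)))
      (.not (.eq (.get .src (.reg rE)) (.get .dst (.reg rE)))))
    ((.assign rA (.get .src (.reg rE)) ;; .assign rD (.get .dst (.reg rE))) ;;
      markBlock ;; selectBlock ;; .cond (.not (.eq (.reg rOk) (.const 0))) emitBlock .skip)
    .skip

/-- The subroutine for 2-connected components. -/
def bccCmd : Cmd :=
  (.assign .count (.const 0) ;; .assign rPos (.const 0) ;; .store .outStart (.const 0) (.const 0)) ;;
  forLoop rE .m bccStep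

/-- The undirected version of the graph in memory. -/
abbrev State.und (σ : State) (n : ℕ) : SimpleGraph (Fin n) := (σ.graph n).toSimpleGraphInclusive

/-- The vertex `x` does not separate `z` from the edge `a b`. -/
def Linked {V : Type*} (H : SimpleGraph V) (a b x z : V) : Prop :=
  (a = x → ∃ p : H.Walk z b, x ∉ p.support) ∧ (a ≠ x → ∃ p : H.Walk z a, x ∉ p.support)

theorem mem_blockOf_iff {V : Type*} {H : SimpleGraph V} {a b z : V} :
    z ∈ blockOf H a b ↔ ∀ x, x ≠ z → Linked H a b x z := by
  refine forall₂_congr fun x hx => ?_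
  by_cases h : a = x
  · rw [if_pos h]; simp [Linked, h]
  · rw [if_neg h]; simp [Linked, h]

/-! ### Correctness and cost of the subroutine for 2-connected components -/

section

variable {n : ℕ} {σ : State}

theorem weak_reach (hσ : σ.Valid n) {x : Fin n} (hx : σ.reg .x = x) {z w : Fin n} (hz : z ≠ x) :
    ReflTransGen (fun u w => ∃ i < σ.reg .m, σ.EdgeAt i u w ∨ σ.EdgeAt i w u) (z : ℕ) (w : ℕ) ↔
      ∃ p : (σ.und n).Walk z w, x ∉ p.support := by
  constructor
  · intro h
    have key : ∀ y : ℕ, ReflTransGen (fun u w => ∃ i < σ.reg .m, σ.EdgeAt i u w ∨ σ.EdgeAt i w u)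
        (z : ℕ) y → ∃ y' : Fin n, (y' : ℕ) = y ∧ ∃ p : (σ.und n).Walk z y', x ∉ p.support := by
      intro y hy
      induction hy with
      | refl => exact ⟨z, rfl, .nil, by simpa using hz.symm⟩
      | @tail y v _ h ih =>
        obtain ⟨y', rfl, p, hp⟩ := ih
        obtain ⟨i, hi, h⟩ := h
        obtain ⟨hs, hd⟩ := hσ.2 i hi
        have hv : v < n ∧ v ≠ x := by
          rcases h with ⟨h2, h3, h4, h5, h6⟩ | ⟨h2, h3, h4, h5, h6⟩
          · exact ⟨h6 ▸ hd, hx ▸ h4⟩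
          · exact ⟨h5 ▸ hs, hx ▸ h3⟩
        obtain ⟨hv, hvx⟩ := hv
        refine ⟨⟨v, hv⟩, rfl, ?_⟩
        -- A loop of the directed graph gives no edge of the simple graph, and the walk then stays
        -- where it is.
        by_cases e : y' = ⟨v, hv⟩
        · exact e ▸ ⟨p, hp⟩
        · have hadj : (σ.und n).Adj y' ⟨v, hv⟩ := by
            refine ⟨e, ?_⟩
            rcases h with ⟨h2, -, -, h5, h6⟩ | ⟨h2, -, -, h5, h6⟩
            · exact .inl ⟨i, hi, h2, h5, h6⟩
            · exact .inr ⟨i, hi, h2, h5, h6⟩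
          refine ⟨p.concat hadj, ?_⟩
          simp only [SimpleGraph.Walk.support_concat, List.mem_append, not_or]
          exact ⟨hp, by simpa [Fin.ext_iff] using hvx.symm⟩
    obtain ⟨y', h1, h2⟩ := key _ h
    obtain rfl : y' = w := Fin.ext h1
    exact h2
  · rintro ⟨p, hp⟩
    clear hz
    induction p with
    | nil => exact .refl
    | @cons u v w hadj q ih =>
      simp only [SimpleGraph.Walk.support_cons, List.mem_cons, not_or] at hp
      have hu : (u : ℕ) ≠ σ.reg .x := by rw [hx]; exact fun e => hp.1 (Fin.ext e.symm)
      have hv : (v : ℕ) ≠ σ.reg .x := by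
        rw [hx]
        intro e
        exact hp.2 (Fin.ext e ▸ SimpleGraph.Walk.start_mem_support q)
      refine .head ?_ (ih hp.2)
      obtain ⟨-, ⟨i, hi, h1, h2, h3⟩ | ⟨i, hi, h1, h2, h3⟩⟩ := hadj
      · exact ⟨i, hi, .inl ⟨h1, hu, hv, h2, h3⟩⟩
      · exact ⟨i, hi, .inr ⟨h1, hv, hu, h2, h3⟩⟩

theorem graph_congr {τ : State} (hm : τ.reg .m = σ.reg .m) (hs : τ.arr .src = σ.arr .src)
    (hd : τ.arr .dst = σ.arr .dst) (ha : τ.arr .alive = σ.arr .alive) :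
    τ.graph n = σ.graph n := by
  simp only [State.graph, hm, hs, hd, ha]

theorem valid_congr {τ : State} (hσ : σ.Valid n) (hn : τ.reg .n = σ.reg .n)
    (hm : τ.reg .m = σ.reg .m) (hs : τ.arr .src = σ.arr .src)
    (hd : τ.arr .dst = σ.arr .dst) : τ.Valid n := by
  simpa only [State.Valid, hn, hm, hs, hd] using hσ

theorem unmarkSeparated_spec (hσ : σ.Valid n) {x a b : Fin n} (hx : σ.reg .x = x)
    (ha : σ.reg rA = a) (hb : σ.reg rD = b) :
    Runs unmarkSeparated σ (900 * (n + σ.reg .m + 1)) fun τ => ∀ z : Fin n,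
      (τ.arr aMark z ≠ 0 ↔ σ.arr aMark z ≠ 0 ∧ (x ≠ z → Linked (σ.und n) a b x z)) := by
  refine Runs.mono (Runs.seq ((weakComponents_spec hσ).frame.mono le_rfl fun τ₁ h₁ =>
    Runs.seq (K₁ := 5) (K₂ := 24 * n + 5) ?_)) (by omega) fun _ h => h
  obtain ⟨hcomp, hr1, ha1⟩ := h₁
  have hn1 : τ₁.reg .n = n := (hr1 _ rfl).trans hσ.1
  have hx1 : τ₁.reg .x = x := (hr1 _ rfl).trans hx
  have hA1 : τ₁.reg rA = a := (hr1 _ rfl).trans ha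
  have hD1 : τ₁.reg rD = b := (hr1 _ rfl).trans hb
  have hm1 : τ₁.arr aMark = σ.arr aMark := ha1 _ rfl
  refine Runs.mono (Runs.of_loopFree rfl ?_) (show _ ≤ 5 by decide) fun _ h => h
  set r : Fin n := if a = x then b else a with hr
  have hrun : (Cmd.cond (.eq (.reg rA) (.reg .x)) (.assign rR (.reg rD))
      (.assign rR (.reg rA))).run τ₁ = τ₁.setReg rR r := by
    simp only [Cmd.run, Test.eval, Expr.eval, decide_eq_true_eq, hA1, hx1, hD1, hr, Fin.ext_iff]
    split <;> rfl
  rw [hrun]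
  have hlink : ∀ z : Fin n, x ≠ z → (Linked (σ.und n) a b x z ↔
      τ₁.arr .comp z = τ₁.arr .comp r) := by
    intro z hz
    rw [hcomp z z.2 r r.2, weak_reach hσ hx hz.symm]
    by_cases e : a = x
    · rw [hr, if_pos e]; simp [Linked, e]
    · rw [hr, if_neg e]; simp [Linked, e]
  refine Runs.mono (Runs.forLoop_frame (N := n) (K := 18) (I := fun i τ => ∀ z : Fin n,
      (τ.arr aMark z ≠ 0 ↔ σ.arr aMark z ≠ 0 ∧ ((z : ℕ) < i → x ≠ z →
        Linked (σ.und n) a b x z))) (by decide) (by simpa using hn1) rfl rfl ?_ ?_) (by omega)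
      fun τ h z => by simpa using h z
  · intro z; simp [hm1]
  · intro i hi τ h1 h2 h3 h4
    refine Runs.mono (Runs.of_loopFree rfl ?_) (show _ ≤ 18 by decide) fun _ h => h
    intro z
    have e1 : τ.reg .x = x := (h2 _ (by decide) rfl).trans (by simpa using hx1)
    have e2 : τ.reg rR = r := (h2 _ (by decide) rfl).trans (by simp)
    have e3 : τ.arr .comp = τ₁.arr .comp := h3 _ rfl
    have hl := hlink z
    have h4z := h4 z
    have hlt : (z : ℕ) < i + 1 ↔ (z : ℕ) < i ∨ (z : ℕ) = i := by omega
    have hxz : x ≠ z ↔ (z : ℕ) ≠ (x : ℕ) := by rw [ne_eq, Fin.ext_iff]; omega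
    simp only [Cmd.run, Test.eval, Expr.eval, h1, e1, e2, e3]
    by_cases hzi : (z : ℕ) = i
    · rw [← hzi] at h4z ⊢
      simp only [lt_irrefl, IsEmpty.forall_iff, and_true] at h4z
      split
      · rename_i hc
        simp only [Bool.and_eq_true, Bool.not_eq_true', decide_eq_false_iff_not] at hc
        simp only [State.setReg_arr, State.setArr_arr, if_true, Function.update_self, ne_eq,
          not_true_eq_false, false_iff, not_and]
        intro _ hcon
        exact hc.2 ((hl (hxz.2 hc.1)).1 (hcon (by omega) (hxz.2 hc.1)))
      · rename_i hc
        simp only [Bool.and_eq_true, Bool.not_eq_true', decide_eq_false_iff_not] at hc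
        rw [State.setReg_arr, h4z]
        refine ⟨fun h => ⟨h, fun _ hxz' => (hl hxz').2 ?_⟩, fun h => h.1⟩
        by_contra hne
        exact hc ⟨hxz.1 hxz', hne⟩
    · have hlt' : (z : ℕ) < i + 1 ↔ (z : ℕ) < i := by omega
      rw [hlt', ← h4z]
      split <;> simp [hzi]

theorem markBlock_spec (hσ : σ.Valid n) {a b : Fin n} (ha : σ.reg rA = a) (hb : σ.reg rD = b) :
    Runs markBlock σ (950 * ((n + 1) * (n + σ.reg .m + 1))) fun τ => ∀ z : Fin n,
      (τ.arr aMark z ≠ 0 ↔ z ∈ blockOf (σ.und n) a b) := by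
  refine Runs.mono (Runs.seq (K₁ := 10 * n + 5)
    (K₂ := (900 * (n + σ.reg .m + 1) + 6) * n + 5) ?_) ?_ fun _ h => h
  · refine (Runs.forLoop_frame (N := n) (K := 4) (I := fun i τ => ∀ z < i, τ.arr aMark z ≠ 0)
      (by decide) hσ.1 rfl rfl (by simp) ?_).frame.mono le_rfl ?_
    · intro i hi τ h1 h2 h3 h4
      refine Runs.mono (Runs.of_loopFree rfl ?_) (show _ ≤ 4 by decide) fun _ h => h
      intro z hz
      simp only [Cmd.run, Expr.eval, h1, State.setReg_arr, State.setArr_arr, if_true,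
        Function.update_apply]
      have := h4 z
      split
      · exact one_ne_zero
      · exact this (by omega)
    · rintro τ₁ ⟨hmark, hr1, ha1⟩
      refine Runs.mono (Runs.forLoop_frame (N := n) (K := 900 * (n + σ.reg .m + 1))
        (I := fun i τ => ∀ z : Fin n, (τ.arr aMark z ≠ 0 ↔ ∀ x : Fin n, (x : ℕ) < i → x ≠ z →
          Linked (σ.und n) a b x z)) (by decide) ((hr1 _ rfl).trans hσ.1) rfl rfl ?_ ?_) le_rfl ?_
      · intro z
        simpa using hmark z z.2
      · intro i hi τ h1 h2 h3 h4
        have hm : τ.reg .m = σ.reg .m := (h2 _ (by decide) rfl).trans (hr1 _ rfl)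
        have hs : τ.arr .src = σ.arr .src := (h3 _ rfl).trans (ha1 _ rfl)
        have hd : τ.arr .dst = σ.arr .dst := (h3 _ rfl).trans (ha1 _ rfl)
        have hv : τ.Valid n := valid_congr hσ ((h2 _ (by decide) rfl).trans (hr1 _ rfl)) hm hs hd
        have hg : τ.graph n = σ.graph n := graph_congr hm hs hd ((h3 _ rfl).trans (ha1 _ rfl))
        refine (unmarkSeparated_spec hv (x := ⟨i, hi⟩) (a := a) (b := b) h1
          ((h2 _ (by decide) rfl).trans ((hr1 _ rfl).trans ha))
          ((h2 _ (by decide) rfl).trans ((hr1 _ rfl).trans hb))).mono (by rw [hm]) ?_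
        intro τ' h z
        have hu : τ.und n = σ.und n := congrArg Digraph.toSimpleGraphInclusive hg
        rw [State.setReg_arr, h z, h4 z, hu]
        constructor
        · rintro ⟨h5, h6⟩ x hx hxz
          rcases Nat.lt_succ_iff_lt_or_eq.mp hx with h7 | h7
          · exact h5 x h7 hxz
          · obtain rfl : x = ⟨i, hi⟩ := Fin.ext h7
            exact h6 hxz
        · exact fun h5 => ⟨fun x hx => h5 x (by omega), fun h6 => h5 ⟨i, hi⟩ (by simp) h6⟩
      · intro τ h z
        rw [h z, mem_blockOf_iff]
        exact ⟨fun h x => h x x.2, fun h x _ => h x⟩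
  · nlinarith [Nat.zero_le (n * σ.reg .m), Nat.zero_le (n * n)]

theorem selectBlock_spec (hσ : σ.reg .n = n) :
    Runs selectBlock σ (40 * (n + σ.reg rE + 1)) fun τ => (τ.reg rOk ≠ 0 ↔
      (∃ z < n, σ.arr aMark z ≠ 0 ∧ z ≠ σ.reg rA ∧ z ≠ σ.reg rD) ∧
      ∀ f < σ.reg rE, ¬ (σ.arr .alive f ≠ 0 ∧ σ.arr .src f ≠ σ.arr .dst f ∧
        σ.arr aMark (σ.arr .src f) ≠ 0 ∧ σ.arr aMark (σ.arr .dst f) ≠ 0)) := by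
  refine Runs.mono (Runs.seq (Runs.of_loopFree rfl (Runs.seq (K₁ := 25 * n + 5)
    (K₂ := 34 * σ.reg rE + 5) ?_))) (by simp only [Cmd.maxCost, Expr.cost]; omega) fun _ h => h
  refine (Runs.forLoop_frame (N := n) (K := 19) (I := fun i τ => (τ.reg rOk ≠ 0 ↔
      ∃ z < i, σ.arr aMark z ≠ 0 ∧ z ≠ σ.reg rA ∧ z ≠ σ.reg rD))
      (by decide) (by simpa [Cmd.run] using hσ) rfl rfl (by simp [Cmd.run, Expr.eval])
      ?_).frame.mono le_rfl ?_
  · intro i hi τ h1 h2 h3 h4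
    refine Runs.mono (Runs.of_loopFree rfl ?_) (show _ ≤ 19 by decide) fun _ h => h
    have e1 : τ.reg rA = σ.reg rA := (h2 _ (by decide) rfl).trans (by simp [Cmd.run])
    have e2 : τ.reg rD = σ.reg rD := (h2 _ (by decide) rfl).trans (by simp [Cmd.run])
    have e3 : τ.arr aMark = σ.arr aMark := h3 _ rfl
    have hreg : ∀ τ' : State, (τ'.setReg rZ (i + 1)).reg rOk = τ'.reg rOk := fun τ' => by simp
    simp only [Cmd.run, Test.eval, Expr.eval, h1, e1, e2, e3]
    rw [hreg]
    split
    · rename_i hc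
      simp only [Bool.and_eq_true, Bool.not_eq_true', decide_eq_false_iff_not] at hc
      rw [State.setReg_reg, if_pos rfl]
      simp only [ne_eq, one_ne_zero, not_false_eq_true, true_iff]
      exact ⟨i, by omega, hc⟩
    · rename_i hc
      simp only [Bool.and_eq_true, Bool.not_eq_true', decide_eq_false_iff_not] at hc
      rw [h4]
      constructor
      · rintro ⟨z, hz, h⟩
        exact ⟨z, by omega, h⟩
      · rintro ⟨z, hz, h⟩
        rcases Nat.lt_succ_iff_lt_or_eq.mp hz with h7 | rfl
        · exact ⟨z, h7, h⟩
        · exact absurd h hc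
  · rintro τ₁ ⟨hok, hr1, ha1⟩
    refine Runs.mono (Runs.forLoop_frame (N := σ.reg rE) (K := 28) (I := fun i τ =>
      (τ.reg rOk ≠ 0 ↔ (∃ z < n, σ.arr aMark z ≠ 0 ∧ z ≠ σ.reg rA ∧ z ≠ σ.reg rD) ∧
      ∀ f < i, ¬ (σ.arr .alive f ≠ 0 ∧ σ.arr .src f ≠ σ.arr .dst f ∧
        σ.arr aMark (σ.arr .src f) ≠ 0 ∧ σ.arr aMark (σ.arr .dst f) ≠ 0)))
      (by decide) ((hr1 _ rfl).trans (by simp [Cmd.run])) rfl rfl (by simpa using hok)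
      ?_) le_rfl fun _ h => h
    intro i hi τ h1 h2 h3 h4
    refine Runs.mono (Runs.of_loopFree rfl ?_) (show _ ≤ 28 by decide) fun _ h => h
    have e1 : τ.arr .alive = σ.arr .alive := (h3 _ rfl).trans (ha1 _ rfl)
    have e2 : τ.arr .src = σ.arr .src := (h3 _ rfl).trans (ha1 _ rfl)
    have e3 : τ.arr .dst = σ.arr .dst := (h3 _ rfl).trans (ha1 _ rfl)
    have e4 : τ.arr aMark = σ.arr aMark := (h3 _ rfl).trans (ha1 _ rfl)
    have hreg : ∀ τ' : State, (τ'.setReg .e (i + 1)).reg rOk = τ'.reg rOk := fun τ' => by simp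
    simp only [Cmd.run, Test.eval, Expr.eval, curSrc, curDst, h1, e1, e2, e3, e4]
    rw [hreg]
    split
    · rename_i hc
      simp only [Bool.and_eq_true, Bool.not_eq_true', decide_eq_false_iff_not] at hc
      rw [State.setReg_reg, if_pos rfl]
      simp only [ne_eq, not_true_eq_false, false_iff]
      rintro ⟨-, h⟩
      exact h i (by omega) hc
    · rename_i hc
      simp only [Bool.and_eq_true, Bool.not_eq_true', decide_eq_false_iff_not] at hc
      rw [h4]
      refine and_congr_right fun _ => ⟨fun h f hf => ?_, fun h f hf => h f (by omega)⟩
      rcases Nat.lt_succ_iff_lt_or_eq.mp hf with h7 | rfl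
      · exact h f h7
      · exact hc

/-- The members of the family `F` have been written to the output. -/
structure State.HasOutput (σ : State) (n : ℕ) (F : Set (Set (Fin n))) : Prop where
  outputs : σ.Outputs n F
  start_count : σ.arr .outStart (σ.reg .count) = σ.reg rPos
  start_le : ∀ k ≤ σ.reg .count, σ.arr .outStart k ≤ σ.reg rPos

theorem State.HasOutput.congr {F : Set (Set (Fin n))} {τ : State} (h : σ.HasOutput n F)
    (h1 : τ.reg .count = σ.reg .count) (h2 : τ.reg rPos = σ.reg rPos)
    (h3 : τ.arr .outStart = σ.arr .outStart) (h4 : τ.arr .outVert = σ.arr .outVert) :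
    τ.HasOutput n F := by
  obtain ⟨⟨h5, h6⟩, h7, h8⟩ := h
  refine ⟨⟨?_, ?_⟩, ?_, ?_⟩
  · have : τ.outputSet n = σ.outputSet n := by
      ext i; simp only [State.outputSet, h3, h4]
    rwa [this, h1]
  · rwa [h1, h3, h4]
  · rwa [h1, h2, h3]
  · rwa [h1, h2, h3]

/-- Appending a component to the output. -/
theorem State.HasOutput.insert {F : Set (Set (Fin n))} {τ : State} {C : Set (Fin n)}
    (h : σ.HasOutput n F) (hC : C ∉ F) (hcount : τ.reg .count = σ.reg .count + 1)
    (hpos : σ.reg rPos ≤ τ.reg rPos)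
    (hstart : τ.arr .outStart =
      Function.update (σ.arr .outStart) (σ.reg .count + 1) (τ.reg rPos))
    (hold : ∀ j < σ.reg rPos, τ.arr .outVert j = σ.arr .outVert j)
    (hlt : ∀ j, σ.reg rPos ≤ j → j < τ.reg rPos → τ.arr .outVert j < n)
    (hinj : Set.InjOn (τ.arr .outVert) (Set.Ico (σ.reg rPos) (τ.reg rPos)))
    (hmem : ∀ v : Fin n, v ∈ C ↔ ∃ j, σ.reg rPos ≤ j ∧ j < τ.reg rPos ∧ τ.arr .outVert j = v) :
    τ.HasOutput n (insert C F) := by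
  obtain ⟨⟨hbij, hspec⟩, hsc, hsl⟩ := h
  have hs1 : ∀ k ≤ σ.reg .count, τ.arr .outStart k = σ.arr .outStart k := fun k hk => by
    rw [hstart, Function.update_of_ne (by omega)]
  have hs2 : τ.arr .outStart (σ.reg .count + 1) = τ.reg rPos := by
    rw [hstart, Function.update_self]
  -- Earlier components occupy cells below the old length of the output, and these are not
  -- overwritten.
  have hold' : ∀ i < σ.reg .count, ∀ j < σ.arr .outStart (i + 1),
      τ.arr .outVert j = σ.arr .outVert j := fun i hi j hj =>
    hold j (hj.trans_le (hsl _ hi))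
  have hset : ∀ i < σ.reg .count, τ.outputSet n i = σ.outputSet n i := by
    intro i hi
    ext v
    simp only [State.outputSet, hs1 i hi.le, hs1 (i + 1) hi, Set.mem_ofPred_eq]
    refine exists_congr fun j => and_congr_right fun _ => and_congr_right fun hj => ?_
    rw [hold' i hi j hj]
  have hnew : τ.outputSet n (σ.reg .count) = C := by
    ext v
    rw [hmem]
    simp only [State.outputSet, hs1 _ le_rfl, hs2, hsc, Set.mem_ofPred_eq]
  refine ⟨⟨?_, ?_⟩, ?_, ?_⟩
  · have hIio : Set.Iio (τ.reg .count) = Insert.insert (σ.reg .count) (Set.Iio (σ.reg .count)) := by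
      rw [hcount]; ext k
      simp only [Set.mem_Iio, Set.mem_insert_iff]
      omega
    have hbij' : Set.BijOn (τ.outputSet n) (Set.Iio (σ.reg .count)) F :=
      hbij.congr fun i hi => (hset i hi).symm
    have := hbij'.insert (a := σ.reg .count) (by rwa [hnew])
    rwa [hnew, ← hIio] at this
  · intro i hi
    rcases Nat.lt_succ_iff_lt_or_eq.mp (hcount ▸ hi) with h1 | rfl
    · rw [hs1 i h1.le, hs1 (i + 1) h1]
      obtain ⟨h2, h3⟩ := hspec i h1
      refine ⟨fun j hj1 hj2 => by rw [hold' i h1 j hj2]; exact h2 j hj1 hj2, h3.congr ?_⟩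
      exact fun j hj => (hold' i h1 j hj.2).symm
    · rw [hs1 _ le_rfl, hs2, hsc]
      exact ⟨hlt, hinj⟩
  · rw [hcount, hs2]
  · intro k hk
    rcases Nat.lt_or_ge k (σ.reg .count + 1) with h1 | h1
    · rw [hs1 k (by omega)]
      exact (hsl k (by omega)).trans hpos
    · obtain rfl : k = σ.reg .count + 1 := by omega
      exact hs2.le

theorem emitBlock_spec {F : Set (Set (Fin n))} (hσ : σ.reg .n = n) (h : σ.HasOutput n F)
    (hC : {z : Fin n | σ.arr aMark z ≠ 0} ∉ F) :
    Runs emitBlock σ (30 * (n + 1)) fun τ =>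
      τ.HasOutput n (insert {z : Fin n | σ.arr aMark z ≠ 0} F) := by
  refine Runs.mono (Runs.seq (K₁ := 20 * n + 5) (K₂ := 6) ((Runs.forLoop_frame (N := n) (K := 14)
    -- All entries written so far are below `i`, so appending the vertex `i` keeps them distinct.
    (I := fun i τ => σ.reg rPos ≤ τ.reg rPos ∧
      (∀ j < σ.reg rPos, τ.arr .outVert j = σ.arr .outVert j) ∧
      (∀ j, σ.reg rPos ≤ j → j < τ.reg rPos → τ.arr .outVert j < i) ∧
      Set.InjOn (τ.arr .outVert) (Set.Ico (σ.reg rPos) (τ.reg rPos)) ∧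
      ∀ v < i, (σ.arr aMark v ≠ 0 ↔
        ∃ j, σ.reg rPos ≤ j ∧ j < τ.reg rPos ∧ τ.arr .outVert j = v))
    (by decide) hσ rfl rfl ?_ ?_).frame.mono le_rfl ?_)) (by omega) fun _ h => h
  · simp
  · rintro i hi τ h1 h2 h3 ⟨h4, h5, h6, h7, h8⟩
    refine Runs.mono (Runs.of_loopFree rfl ?_) (show _ ≤ 14 by decide) fun _ h => h
    have e3 : τ.arr aMark = σ.arr aMark := h3 _ rfl
    simp only [Cmd.run, incr, Test.eval, Expr.eval, h1, e3]
    split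
    · rename_i hc
      simp only [Bool.not_eq_true', decide_eq_false_iff_not] at hc
      simp only [rPos, rZ, State.setReg_reg, State.setReg_arr, State.setArr_reg, State.setArr_arr,
        Reg.tmp.injEq, if_true, Nat.reduceEqDiff, if_false] at h4 h5 h6 h7 h8 ⊢
      refine ⟨by omega, fun j hj => ?_, fun j hj1 hj2 => ?_, ?_, fun v hv => ?_⟩
      · rw [Function.update_of_ne (by omega)]; exact h5 j hj
      · rw [Function.update_apply]
        have := h6 j hj1
        split <;> omega
      · intro j hj k hk hjk
        obtain ⟨hj1, hj2⟩ := hj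
        obtain ⟨hk1, hk2⟩ := hk
        rw [Function.update_apply, Function.update_apply] at hjk
        have hj3 := h6 j hj1
        have hk3 := h6 k hk1
        split at hjk <;> split at hjk
        · omega
        · omega
        · omega
        · exact h7 ⟨hj1, by omega⟩ ⟨hk1, by omega⟩ hjk
      · rcases Nat.lt_succ_iff_lt_or_eq.mp hv with h9 | rfl
        · rw [h8 v h9]
          constructor
          · rintro ⟨j, hj1, hj2, hj3⟩
            exact ⟨j, hj1, by omega, by rwa [Function.update_of_ne (by omega)]⟩
          · rintro ⟨j, hj1, hj2, hj3⟩
            rw [Function.update_apply] at hj3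
            split at hj3
            · omega
            · exact ⟨j, hj1, by omega, hj3⟩
        · exact ⟨fun _ => ⟨τ.reg (.tmp 16), h4, by omega, by simp⟩, fun _ => hc⟩
    · rename_i hc
      simp only [Bool.not_eq_true', decide_eq_false_iff_not, not_not] at hc
      have hreg : (τ.setReg rZ (i + 1)).reg rPos = τ.reg rPos := by simp
      rw [hreg, State.setReg_arr]
      refine ⟨h4, h5, fun j hj1 hj2 => (h6 j hj1 hj2).trans (by omega), h7, fun v hv => ?_⟩
      rcases Nat.lt_succ_iff_lt_or_eq.mp hv with h9 | rfl
      · exact h8 v h9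
      · refine ⟨fun h => absurd hc h, ?_⟩
        rintro ⟨j, hj1, hj2, hj3⟩
        have := h6 j hj1 hj2
        omega
  · rintro τ ⟨⟨h4, h5, h6, h7, h8⟩, hr, ha⟩
    have e1 : τ.reg .count = σ.reg .count := hr _ rfl
    have e2 : τ.arr .outStart = σ.arr .outStart := ha _ rfl
    refine Runs.mono (Runs.of_loopFree rfl ?_) (show _ ≤ 6 by decide) fun _ h => h
    have hrun : (incr .count ;; .store .outStart (.reg .count) (.reg rPos) : Cmd).run τ =
        (τ.setReg .count (σ.reg .count + 1)).setArr .outStart (σ.reg .count + 1) (τ.reg rPos) := by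
      simp [incr, Cmd.run, Expr.eval, e1]
    rw [hrun]
    refine h.insert hC ?_ ?_ ?_ ?_ ?_ ?_ ?_
    · simp
    · simpa using h4
    · simp [e2]
    · simpa using h5
    · simpa using h6
    · simpa using h7
    · intro v
      simpa using h8 v v.2

/-- The 2-connected components that contain one of the first `i` edges. -/
def State.firstBlocks (σ : State) (n i : ℕ) : Set (Set (Fin n)) :=
  {C | ∃ e < i, ∃ a b : Fin n, σ.arr .alive e ≠ 0 ∧ σ.arr .src e = a ∧ σ.arr .dst e = b ∧ a ≠ b ∧
    C = blockOf (σ.und n) a b ∧ 3 ≤ C.ncard}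

theorem firstBlocks_eq :
    σ.firstBlocks n (σ.reg .m) = twoConnectedComponents (σ.und n) := by
  ext C
  rw [mem_twoConnectedComponents]
  constructor
  · rintro ⟨e, he, a, b, h1, h2, h3, h4, h5⟩
    exact ⟨a, b, ⟨h4, .inl ⟨e, he, h1, h2, h3⟩⟩, h5⟩
  · rintro ⟨a, b, hab, rfl, hC⟩
    obtain ⟨hne, ⟨e, he, h1, h2, h3⟩ | ⟨e, he, h1, h2, h3⟩⟩ := id hab
    · exact ⟨e, he, a, b, h1, h2, h3, hne, rfl, hC⟩
    -- The edge may be stored in the other direction, and `blockOf` is not symmetric by definition: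
    -- it depends on the order of the ends. For blocks with three vertices the order does not
    -- matter.
    · exact ⟨e, he, b, a, h1, h2, h3, hne.symm, (blockOf_eq hab hab.symm hC
        (right_mem_blockOf hab) (left_mem_blockOf a b)).symm, hC⟩

theorem bccStep_spec (hσ : σ.Valid n) {i : ℕ} (hi : i < σ.reg .m) (hE : σ.reg rE = i)
    (h : σ.HasOutput n (σ.firstBlocks n i)) :
    Runs bccStep σ (1100 * ((n + 1) * (n + σ.reg .m + 1))) fun τ =>
      τ.HasOutput n (σ.firstBlocks n (i + 1)) := by
  obtain ⟨hs, hd⟩ := hσ.2 i hi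
  have hpos : n + σ.reg .m + 1 ≤ (n + 1) * (n + σ.reg .m + 1) :=
    Nat.le_mul_of_pos_left _ (by omega)
  have hsub : σ.firstBlocks n i ⊆ σ.firstBlocks n (i + 1) := by
    rintro C ⟨e, he, h⟩
    exact ⟨e, by omega, h⟩
  refine Runs.mono (Runs.cond (K := 1050 * ((n + 1) * (n + σ.reg .m + 1))) (fun hb => ?_)
    (fun hb => ?_)) (by simp only [Test.cost, Expr.cost]; omega) fun _ h => h
  · simp only [Test.eval, Bool.and_eq_true, Bool.not_eq_true', decide_eq_false_iff_not,
      Expr.eval, hE] at hb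
    obtain ⟨halive, hne⟩ := hb
    set a : Fin n := ⟨_, hs⟩ with ha
    set b : Fin n := ⟨_, hd⟩ with hb
    have hab' : a ≠ b := fun e => hne (Fin.ext_iff.1 e)
    have hab : (σ.und n).Adj a b := ⟨hab', .inl ⟨i, hi, halive, rfl, rfl⟩⟩
    have hfirst : σ.firstBlocks n (i + 1) = σ.firstBlocks n i ∪
        {C | C = blockOf (σ.und n) a b ∧ 3 ≤ C.ncard} := by
      ext C
      constructor
      · rintro ⟨e, he, a', b', h1, h2, h3, h4, h5⟩
        rcases Nat.lt_succ_iff_lt_or_eq.mp he with h6 | rfl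
        · exact .inl ⟨e, h6, a', b', h1, h2, h3, h4, h5⟩
        · obtain rfl : a = a' := Fin.ext h2
          obtain rfl : b = b' := Fin.ext h3
          exact .inr h5
      · rintro (h1 | h1)
        · exact hsub h1
        · exact ⟨i, by omega, a, b, halive, rfl, rfl, hab', h1⟩
    -- This turns the question whether the block was listed before into the test made by
    -- `selectBlock`, without a comparison of sets.
    have hmemFirst : 3 ≤ (blockOf (σ.und n) a b).ncard →
        (blockOf (σ.und n) a b ∈ σ.firstBlocks n i ↔ ∃ f < i, σ.arr .alive f ≠ 0 ∧
          ∃ c d : Fin n, σ.arr .src f = c ∧ σ.arr .dst f = d ∧ c ≠ d ∧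
            c ∈ blockOf (σ.und n) a b ∧ d ∈ blockOf (σ.und n) a b) := by
      intro hcard
      constructor
      · rintro ⟨f, hf, c, d, h1, h2, h3, h4, h5, -⟩
        refine ⟨f, hf, h1, c, d, h2, h3, h4, ?_, ?_⟩
        · rw [h5]; exact left_mem_blockOf c d
        · rw [h5]; exact right_mem_blockOf ⟨h4, .inl ⟨f, by omega, h1, h2, h3⟩⟩
      · rintro ⟨f, hf, h1, c, d, h2, h3, h4, h5, h6⟩
        exact ⟨f, hf, c, d, h1, h2, h3, h4, (blockOf_eq hab
          ⟨h4, .inl ⟨f, by omega, h1, h2, h3⟩⟩ hcard h5 h6).symm, hcard⟩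
    refine Runs.mono (Runs.seq (K₁ := 6) (K₂ := 950 * ((n + 1) * (n + σ.reg .m + 1)) +
      (40 * (n + σ.reg .m + 1) + (4 + 30 * (n + 1)))) (Runs.mono (Runs.of_loopFree rfl ?_)
      (show _ ≤ 6 by decide) fun _ h => h)) (by omega) fun _ h => h
    set σ₁ := (σ.setReg rA a).setReg rD b with hσ₁
    have hrun : (.assign rA (.get .src (.reg rE)) ;; .assign rD (.get .dst (.reg rE)) : Cmd).run σ =
        σ₁ := by
      simp only [rE] at hE
      simp [Cmd.run, Expr.eval, hσ₁, hE, ha, hb]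
    rw [hrun]
    have hv1 : σ₁.Valid n := valid_congr hσ (by simp [hσ₁]) (by simp [hσ₁]) rfl rfl
    have hg1 : σ₁.graph n = σ.graph n := graph_congr (by simp [hσ₁]) rfl rfl rfl
    have hm1 : σ₁.reg .m = σ.reg .m := by simp [hσ₁]
    have ho1 : σ₁.HasOutput n (σ.firstBlocks n i) :=
      h.congr (by simp [hσ₁]) (by simp [hσ₁]) rfl rfl
    have hA1 : σ₁.reg rA = a := by simp [hσ₁]
    have hD1 : σ₁.reg rD = b := by simp [hσ₁]
    have hE1 : σ₁.reg rE = i := by simpa [hσ₁] using hE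
    refine Runs.seq ((markBlock_spec hv1 hA1 hD1).frame.mono (by rw [hm1]) ?_)
    rintro σ₂ ⟨hmark, hr2, ha2⟩
    rw [State.und, hg1] at hmark
    have hA2 : σ₂.reg rA = a := (hr2 _ rfl).trans hA1
    have hD2 : σ₂.reg rD = b := (hr2 _ rfl).trans hD1
    have hE2 : σ₂.reg rE = i := (hr2 _ rfl).trans hE1
    have hn2 : σ₂.reg .n = n := (hr2 _ rfl).trans hv1.1
    have ho2 := ho1.congr (hr2 _ rfl) (hr2 _ rfl) (ha2 _ rfl) (ha2 _ rfl)
    have hal2 : σ₂.arr .alive = σ.arr .alive := ha2 _ rfl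
    have hs2 : σ₂.arr .src = σ.arr .src := ha2 _ rfl
    have hd2 : σ₂.arr .dst = σ.arr .dst := ha2 _ rfl
    refine Runs.seq ((selectBlock_spec hn2).frame.mono (by rw [hE2]; omega) ?_)
    rintro σ₃ ⟨hok, hr3, ha3⟩
    have hmark3 : σ₃.arr aMark = σ₂.arr aMark := ha3 _ rfl
    have hn3 : σ₃.reg .n = n := (hr3 _ rfl).trans hn2
    have ho3 := ho2.congr (hr3 _ rfl) (hr3 _ rfl) (ha3 _ rfl) (ha3 _ rfl)
    have hset : {z : Fin n | σ₃.arr aMark z ≠ 0} = blockOf (σ.und n) a b := by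
      ext z
      rw [Set.mem_ofPred_eq, hmark3, hmark z]
    have hok' : σ₃.reg rOk ≠ 0 ↔ 3 ≤ (blockOf (σ.und n) a b).ncard ∧
        blockOf (σ.und n) a b ∉ σ.firstBlocks n i := by
      rw [hok, hA2, hD2, hE2, hal2, hs2, hd2]
      have h1 : (∃ z < n, σ₂.arr aMark z ≠ 0 ∧ z ≠ a ∧ z ≠ b) ↔
          3 ≤ (blockOf (σ.und n) a b).ncard := by
        rw [three_le_ncard_blockOf hab]
        constructor
        · rintro ⟨z, hz, h2, h3, h4⟩
          exact ⟨⟨z, hz⟩, (hmark ⟨z, hz⟩).1 h2, fun e => h3 (Fin.ext_iff.1 e),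
            fun e => h4 (Fin.ext_iff.1 e)⟩
        · rintro ⟨z, h2, h3, h4⟩
          exact ⟨z, z.2, (hmark z).2 h2, fun e => h3 (Fin.ext e), fun e => h4 (Fin.ext e)⟩
      rw [h1]
      refine and_congr_right fun hcard => ?_
      rw [hmemFirst hcard]
      push Not
      refine forall₂_congr fun f hf => ?_
      obtain ⟨hsf, hdf⟩ := hσ.2 f (by omega)
      constructor
      · rintro h2 h3 c d h4 h5 h6 h7 h8
        rw [h4, h5] at h2
        exact (hmark d).2 h8 (h2 h3 (fun e => h6 (Fin.ext e)) ((hmark c).2 h7))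
      · intro h2 h3 h4 h5
        by_contra h6
        exact h2 h3 ⟨_, hsf⟩ ⟨_, hdf⟩ rfl rfl (fun e => h4 (Fin.ext_iff.1 e))
          ((hmark ⟨_, hsf⟩).1 h5) ((hmark ⟨_, hdf⟩).1 h6)
    refine Runs.mono (Runs.cond (K := 30 * (n + 1)) (fun hb => ?_) (fun hb => ?_))
      (by simp only [Test.cost, Expr.cost]; omega) fun _ h => h
    · simp only [Test.eval, Bool.not_eq_true', decide_eq_false_iff_not] at hb
      obtain ⟨h1, h2⟩ := hok'.1 hb
      rw [← hset] at h2
      refine (emitBlock_spec hn3 ho3 h2).mono le_rfl fun τ h3 => ?_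
      rw [hset] at h3
      convert h3 using 1
      rw [hfirst, Set.union_comm]
      ext C
      simp only [Set.mem_union, Set.mem_insert_iff, Set.mem_ofPred_eq]
      refine or_congr_left ⟨fun h => h.1, fun h => ⟨h, h ▸ h1⟩⟩
    · simp only [Test.eval, Bool.not_eq_false', decide_eq_true_eq] at hb
      refine Runs.mono (Runs.of_loopFree rfl ?_) (show 1 ≤ _ by omega) fun _ h => h
      have : σ.firstBlocks n (i + 1) = σ.firstBlocks n i := by
        rw [hfirst]
        refine Set.union_eq_self_of_subset_right ?_
        rintro C ⟨rfl, hC⟩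
        by_contra h1
        exact hok'.2 ⟨hC, h1⟩ hb
      rw [this]
      exact ho3
  · simp only [Test.eval, Expr.eval, hE] at hb
    refine Runs.mono (Runs.of_loopFree rfl ?_) (show 1 ≤ _ by omega) fun _ h => h
    have : σ.firstBlocks n (i + 1) = σ.firstBlocks n i := by
      refine Set.Subset.antisymm ?_ hsub
      rintro C ⟨e, he, a', b', h1, h2, h3, h4, h5⟩
      rcases Nat.lt_succ_iff_lt_or_eq.mp he with h6 | rfl
      · exact ⟨e, h6, a', b', h1, h2, h3, h4, h5⟩
      · rw [h2, h3] at hb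
        have h7 : (a' : ℕ) ≠ b' := fun e => h4 (Fin.ext e)
        simp [h1, h7] at hb
    rw [this]
    exact h

theorem bccCmd_spec (hσ : σ.Valid n) :
    Runs bccCmd σ (1200 * ((σ.reg .m + 1) * ((n + 1) * (n + σ.reg .m + 1)))) fun τ =>
      τ.Outputs n (twoConnectedComponents (σ.und n)) := by
  refine Runs.mono (Runs.seq (K₁ := 7)
    (K₂ := (1100 * ((n + 1) * (n + σ.reg .m + 1)) + 6) * σ.reg .m + 5)
    (Runs.mono (Runs.of_loopFree rfl ?_) (show _ ≤ 7 by decide) fun _ h => h)) ?_ fun _ h => h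
  · refine Runs.mono (Runs.forLoop_frame (N := σ.reg .m)
      (K := 1100 * ((n + 1) * (n + σ.reg .m + 1)))
      (I := fun i τ => τ.HasOutput n (σ.firstBlocks n i)) (by decide) (by simp [Cmd.run]) rfl rfl
      ?_ ?_) le_rfl ?_
    · refine ⟨⟨?_, ?_⟩, ?_, ?_⟩
      · have h1 : σ.firstBlocks n 0 = ∅ := by
          ext C; simp [State.firstBlocks]
        rw [h1]
        simp [Cmd.run, Expr.eval]
      · simp [Cmd.run, Expr.eval]
      · simp [Cmd.run, Expr.eval]
      · simp [Cmd.run, Expr.eval]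
    · intro i hi τ h1 h2 h3 h4
      have hm : τ.reg .m = σ.reg .m := (h2 _ (by decide) rfl).trans (by simp [Cmd.run])
      have hn : τ.reg .n = σ.reg .n := (h2 _ (by decide) rfl).trans (by simp [Cmd.run])
      have hs : τ.arr .src = σ.arr .src := h3 _ rfl
      have hd : τ.arr .dst = σ.arr .dst := h3 _ rfl
      have ha : τ.arr .alive = σ.arr .alive := h3 _ rfl
      have hf : ∀ j, τ.firstBlocks n j = σ.firstBlocks n j := fun j => by
        simp only [State.firstBlocks, State.und, graph_congr (n := n) hm hs hd ha, hs, hd, ha]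
      have := bccStep_spec (valid_congr hσ hn hm hs hd) (hm ▸ hi) h1 (by rwa [hf])
      refine this.mono (by rw [hm]) fun τ' h5 => ?_
      rw [hf] at h5
      exact h5.congr (by simp) (by simp) rfl rfl
    · intro τ h
      rw [firstBlocks_eq] at h
      exact h.outputs
  · generalize hP : (n + 1) * (n + σ.reg .m + 1) = P
    have : 1 ≤ P := hP ▸ Nat.mul_pos (by omega) (by omega)
    nlinarith [Nat.mul_le_mul_right (σ.reg .m) this]

end

theorem bccCmd_computes : ComputesTwoConnectedComponents bccCmd := by
  intro n σ hσ
  obtain ⟨σ', t, he, -, h⟩ := bccCmd_spec hσ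
  exact ⟨σ', t, he, ⟨he.reg_eq rfl, he.reg_eq rfl, he.arr_eq rfl, he.arr_eq rfl, he.arr_eq rfl⟩, h⟩

/-! ### The running time of the algorithm -/

/-- The number of edges that have not been removed. -/
def State.aliveCount (σ : State) : ℕ :=
  ((Finset.range (σ.reg .m)).filter fun e => σ.arr .alive e ≠ 0).card

section

variable {n : ℕ} {σ : State}

/-- The flag is set only right after a live edge has been cleared. The component labels play no role
in this count. -/
theorem removeBetween_spec :
    Runs removeBetween σ (37 * σ.reg .m + 5) fun τ => τ.aliveCount ≤ σ.aliveCount ∧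
      (τ.reg .changed ≠ 0 → σ.reg .changed ≠ 0 ∨ τ.aliveCount < σ.aliveCount) := by
  refine (Runs.forLoop_frame (N := σ.reg .m) (K := 31) (I := fun _ τ => τ.reg .m = σ.reg .m ∧
    τ.aliveCount ≤ σ.aliveCount ∧
      (τ.reg .changed ≠ 0 → σ.reg .changed ≠ 0 ∨ τ.aliveCount < σ.aliveCount))
    (by decide) rfl rfl rfl ?_ ?_).mono le_rfl fun _ h => h.2
  · refine ⟨by simp, by simp [State.aliveCount], fun h => .inl (by simpa using h)⟩
  · rintro i hi τ h1 - - ⟨h2, h3, h4⟩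
    refine Runs.mono (Runs.of_loopFree rfl ?_) (show _ ≤ 31 by decide) fun _ h => h
    have hset : ∀ τ' : State, (τ'.setReg .e (i + 1)).aliveCount = τ'.aliveCount := fun τ' => by
      simp [State.aliveCount]
    have hreg : ∀ τ' : State, ∀ r, r ≠ .e → (τ'.setReg .e (i + 1)).reg r = τ'.reg r :=
      fun τ' r hr => by simp [hr]
    rw [hset, hreg _ _ (by decide), hreg _ _ (by decide)]
    rw [Cmd.run]
    split
    · rename_i hc
      have halive : τ.arr .alive i ≠ 0 := by
        simp only [isBetween, Test.eval, Bool.and_eq_true, Bool.not_eq_true',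
          decide_eq_false_iff_not] at hc
        have := hc.1
        simpa only [Expr.eval, h1] using this
      have hlt : ((Cmd.store .alive (.reg .e) (.const 0) ;; .assign .changed (.const 1)).run
          τ).aliveCount < τ.aliveCount := by
        refine Finset.card_lt_card (Finset.ssubset_iff_of_subset ?_ |>.2 ⟨i, ?_, ?_⟩)
        · intro e
          simp only [Cmd.run, Expr.eval, h1, Finset.mem_filter, State.setReg_reg, State.setArr_reg,
            State.setReg_arr, State.setArr_arr, if_true, Function.update_apply, reduceCtorEq,
            if_false]
          split <;> simp
        · simpa [halive, h2] using hi
        · simp [Cmd.run, Expr.eval, h1]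
      exact ⟨by simp [Cmd.run, h2], hlt.le.trans h3, fun _ => .inr (hlt.trans_le h3)⟩
    · exact ⟨h2, h3, h4⟩

theorem sccRemove_spec (hσ : σ.Valid n) :
    Runs (sccCmd ;; removeBetween) σ (850 * (n + σ.reg .m + 1)) fun τ =>
      τ.aliveCount ≤ σ.aliveCount ∧
      (τ.reg .changed ≠ 0 → σ.reg .changed ≠ 0 ∨ τ.aliveCount < σ.aliveCount) := by
  refine Runs.mono (Runs.seq (K₂ := 37 * σ.reg .m + 5) ((sccCmd_spec hσ).frame.mono le_rfl ?_))
    (by omega) fun _ h => h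
  rintro τ₁ ⟨-, hr, ha⟩
  have hm : τ₁.reg .m = σ.reg .m := hr _ rfl
  have hcount : τ₁.aliveCount = σ.aliveCount := by
    simp only [State.aliveCount, hm, ha .alive rfl]
  have hchanged : τ₁.reg .changed = σ.reg .changed := hr _ rfl
  have := removeBetween_spec (σ := τ₁)
  rwa [hm, hcount, hchanged] at this

theorem iteration_spec (hσ : σ.Valid n) :
    Runs (iteration sccCmd) σ (900 * ((n + 1) * (n + σ.reg .m + 1))) fun τ =>
      τ.aliveCount ≤ σ.aliveCount ∧ (τ.reg .changed ≠ 0 → τ.aliveCount < σ.aliveCount) := by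
  refine Runs.mono (Runs.seq (Runs.of_loopFree rfl (Runs.seq (K₁ := 800 * (n + σ.reg .m + 1))
    (K₂ := 37 * σ.reg .m + 5 + (2 + ((850 * (n + σ.reg .m + 1) + 6) * n + 5))) ?_))) ?_ fun _ h => h
  · set σ₀ := (Cmd.assign .x (.reg .n)).run σ with hσ₀
    have hm0 : σ₀.reg .m = σ.reg .m := by simp [hσ₀, Cmd.run]
    have hv0 : σ₀.Valid n := valid_congr hσ (by simp [hσ₀, Cmd.run]) hm0 rfl rfl
    have hc0 : σ₀.aliveCount = σ.aliveCount := by simp [State.aliveCount, hσ₀, Cmd.run]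
    refine (sccCmd_spec hv0).frame.mono (by rw [hm0]) ?_
    rintro σ₁ ⟨-, hr1, ha1⟩
    have hm1 : σ₁.reg .m = σ.reg .m := (hr1 _ rfl).trans hm0
    have hv1 : σ₁.Valid n := valid_congr hv0 (hr1 _ rfl) (hr1 _ rfl) (ha1 _ rfl) (ha1 _ rfl)
    have hc1 : σ₁.aliveCount = σ.aliveCount := by
      rw [← hc0]; simp only [State.aliveCount, hm1, hm0, ha1 .alive rfl]
    refine Runs.seq (removeBetween_spec.frame.mono (by rw [hm1]) ?_)
    rintro σ₂ ⟨⟨hc2, -⟩, hr2, ha2⟩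
    have hm2 : σ₂.reg .m = σ.reg .m := (hr2 _ rfl).trans hm1
    have hv2 : σ₂.Valid n := valid_congr hv1 (hr2 _ rfl) (hr2 _ rfl) (ha2 _ rfl) (ha2 _ rfl)
    rw [hc1] at hc2
    -- The flag is cleared after the pass over the whole graph, so only edges removed in step (b)
    -- can set it.
    refine Runs.seq (Runs.of_loopFree (c := Cmd.assign .changed (.const 0)) rfl ?_)
    set σ₃ := (Cmd.assign .changed (.const 0)).run σ₂ with hσ₃
    have hm3 : σ₃.reg .m = σ.reg .m := by simpa [hσ₃, Cmd.run] using hm2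
    have hv3 : σ₃.Valid n := valid_congr hv2 (by simp [hσ₃, Cmd.run]) (by rw [hm3, hm2]) rfl rfl
    have hc3 : σ₃.aliveCount ≤ σ.aliveCount := by
      simpa [State.aliveCount, hσ₃, Cmd.run] using hc2
    refine Runs.forLoop_frame (N := n) (I := fun _ τ => τ.aliveCount ≤ σ.aliveCount ∧
      (τ.reg .changed ≠ 0 → τ.aliveCount < σ.aliveCount)) (by decide) hv3.1 rfl rfl ?_ ?_
    · refine ⟨by simpa [State.aliveCount] using hc3, ?_⟩
      simp [hσ₃, Cmd.run, Expr.eval]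
    · rintro i hi τ - h2 h3 ⟨h4, h5⟩
      have hm : τ.reg .m = σ.reg .m := (h2 _ (by decide) rfl).trans hm3
      have hv : τ.Valid n := valid_congr hv3 (h2 _ (by decide) rfl) (by rw [hm, hm3])
        (h3 _ rfl) (h3 _ rfl)
      refine (sccRemove_spec hv).mono (by rw [hm]) ?_
      rintro τ' ⟨h6, h7⟩
      have hc : (τ'.setReg .x (i + 1)).aliveCount = τ'.aliveCount := by simp [State.aliveCount]
      have hch : (τ'.setReg .x (i + 1)).reg .changed = τ'.reg .changed := by simp
      rw [hc, hch]
      refine ⟨h6.trans h4, fun h8 => ?_⟩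
      rcases h7 h8 with h9 | h9
      · exact h6.trans_lt (h5 h9)
      · exact h9.trans_le h4
  · simp only [Cmd.maxCost, Expr.cost]
    nlinarith [Nat.zero_le (n * σ.reg .m), Nat.zero_le (n * n)]

theorem erusalimskiiSvetlov_spec (hσ : σ.Valid n) :
    Runs (erusalimskiiSvetlov sccCmd bccCmd) σ
      (4000 * ((σ.reg .m + 1) * ((n + 1) * (n + σ.reg .m + 1)))) fun τ =>
      τ.Outputs n (twoConnectedComponents (τ.und n)) := by
  set P := (n + 1) * (n + σ.reg .m + 1) with hP
  have hP1 : 1 ≤ P := Nat.mul_pos (by omega) (by omega)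
  refine Runs.mono (Runs.seq (K₁ := 9 * σ.reg .m + 5)
    (K₂ := 900 * P + ((900 * P + 4) * (σ.reg .m + 1) + 4) + 1200 * ((σ.reg .m + 1) * P))
    ((Runs.forLoop_frame (N := σ.reg .m) (K := 3) (I := fun _ _ => True) (by decide) rfl rfl rfl
      trivial fun i hi τ _ _ _ _ => Runs.mono (Runs.of_loopFree rfl trivial)
        (show _ ≤ 3 by decide) fun _ h => h).frame.mono le_rfl ?_)) ?_ fun _ h => h
  · rintro σ₁ ⟨-, hr1, ha1⟩
    have hm1 : σ₁.reg .m = σ.reg .m := hr1 _ rfl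
    have hv1 : σ₁.Valid n := valid_congr hσ (hr1 _ rfl) hm1 (ha1 _ rfl) (ha1 _ rfl)
    refine Runs.seq (Runs.mono (Runs.seq ((iteration_spec hv1).frame.mono
      (by rw [hm1]) fun σ₂ h => Runs.loop (K := 900 * P)
        -- The potential bounds the number of live edges plus one, so a unit remains even if the
        -- flag is set and no edge is left. At most m edges are live, hence the start value m + 1.
        (I := fun φ τ => τ.reg .m = σ.reg .m ∧ τ.Valid n ∧
          (τ.reg .changed ≠ 0 → τ.aliveCount + 1 ≤ φ)) ?_ (σ.reg .m + 1) _ ?_))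
      le_rfl ?_)
    · rintro φ τ ⟨h1, h2, h3⟩ hb
      have hch : τ.reg .changed ≠ 0 := by
        simp only [Test.eval, Bool.not_eq_true', decide_eq_false_iff_not] at hb
        exact hb
      have h4 := h3 hch
      refine ⟨φ - 1, 0, by omega, (iteration_spec h2).frame.mono (by rw [h1, zero_add, mul_one]) ?_⟩
      rintro τ' ⟨⟨-, h6⟩, hr, ha⟩
      refine ⟨(hr _ rfl).trans h1, valid_congr h2 (hr _ rfl) (hr _ rfl) (ha _ rfl) (ha _ rfl),
        fun h7 => ?_⟩
      have := h6 h7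
      omega
    · obtain ⟨-, hr2, ha2⟩ := h
      have hm2 : σ₂.reg .m = σ.reg .m := (hr2 _ rfl).trans hm1
      refine ⟨hm2, valid_congr hv1 (hr2 _ rfl) (hr2 _ rfl) (ha2 _ rfl) (ha2 _ rfl), fun _ => ?_⟩
      have : σ₂.aliveCount ≤ (Finset.range (σ₂.reg .m)).card :=
        Finset.card_le_card (Finset.filter_subset _ _)
      rw [Finset.card_range, hm2] at this
      omega
    · rintro σ₂ ⟨-, φ, hm2, hv2, -⟩
      refine (bccCmd_spec hv2).frame.mono (by rw [hm2]) ?_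
      rintro τ ⟨h, hr, ha⟩
      have hg : τ.graph n = σ₂.graph n := graph_congr (hr _ rfl) (ha _ rfl) (ha _ rfl) (ha _ rfl)
      rw [State.und, hg]
      exact h
  · nlinarith [Nat.mul_le_mul_right (σ.reg .m) hP1]

/-! ### The bound for the given input -/

theorem initState_valid (n : ℕ) (es : List (Fin n × Fin n)) : (initState n es).Valid n := by
  refine ⟨rfl, fun e he => ?_⟩
  have he' : e < es.length := he
  constructor <;> simp [initState, he']

theorem erusalimskiiSvetlov_bound {n : ℕ} (hn : 0 < n) (es : List (Fin n × Fin n)) :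
    Runs (erusalimskiiSvetlov sccCmd bccCmd) (initState n es)
      (16000 * ((es.length + 1) * (n * (n + es.length)))) fun τ =>
      τ.Outputs n (twoConnectedComponents (τ.und n)) := by
  refine (erusalimskiiSvetlov_spec (initState_valid n es)).mono ?_ fun _ h => h
  have hm : (initState n es).reg .m = es.length := rfl
  rw [hm]
  -- For n ≥ 1 each of the two factors with an additive one at most doubles, hence 16000.
  calc 4000 * ((es.length + 1) * ((n + 1) * (n + es.length + 1)))
      ≤ 4000 * ((es.length + 1) * ((2 * n) * (2 * (n + es.length)))) := by
        gcongr <;> omega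
    _ = _ := by ring

end

end ErSv

/-- The strongly connected components and the 2-connected components can be computed by
subroutines with which the algorithm halts on every directed graph `G` with `n ≥ 1` vertices and
`m` edges, outputs the 2-connected components of the undirected version of the remaining graph,
and takes `O((m + 1) n (n + m))` steps; this is `O(n m ^ 2)` on the graphs with `n = O(m)`. -/
theorem mainTheorem6 :
    ∃ scc bcc : ErSv.Cmd, ErSv.ComputesSCC scc ∧ ErSv.ComputesTwoConnectedComponents bcc ∧
      (∃ C : ℕ, ∀ (n : ℕ) (G : Digraph (Fin n)) (es : List (Fin n × Fin n)),
        ErSv.IsEdgeList G es → 0 < n →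
        ∃ (σ : ErSv.State) (t : ℕ),
          ErSv.Exec (ErSv.erusalimskiiSvetlov scc bcc) (ErSv.initState n es) σ t ∧
          σ.Outputs n (ErSv.twoConnectedComponents (σ.graph n).toSimpleGraphInclusive) ∧
          t ≤ C * ((es.length + 1) * (n * (n + es.length)))) ∧
      (∀ K : ℕ, ∃ C : ℕ, ∀ (n : ℕ) (G : Digraph (Fin n)) (es : List (Fin n × Fin n)),
        ErSv.IsEdgeList G es → 0 < n → n ≤ K * es.length →
        ∃ (σ : ErSv.State) (t : ℕ),
          ErSv.Exec (ErSv.erusalimskiiSvetlov scc bcc) (ErSv.initState n es) σ t ∧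
          σ.Outputs n (ErSv.twoConnectedComponents (σ.graph n).toSimpleGraphInclusive) ∧
          t ≤ C * (n * es.length ^ 2)) := by
  refine ⟨ErSv.sccCmd, ErSv.bccCmd, ErSv.sccCmd_computesSCC, ErSv.bccCmd_computes,
    ⟨16000, fun n G es _ hn => ?_⟩, fun K => ⟨32000 * (K + 1), fun n G es _ hn hK => ?_⟩⟩
  · obtain ⟨σ, t, h1, h2, h3⟩ := ErSv.erusalimskiiSvetlov_bound hn es
    exact ⟨σ, t, h1, h3, h2⟩
  · obtain ⟨σ, t, h1, h2, h3⟩ := ErSv.erusalimskiiSvetlov_bound hn es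
    refine ⟨σ, t, h1, h3, h2.trans ?_⟩
    -- Since 1 ≤ n ≤ K m there is an edge, so m + 1 ≤ 2m, and n + m ≤ (K + 1) m.
    have hm : 1 ≤ es.length := Nat.pos_of_ne_zero fun h0 => by simp [h0] at hK; omega
    calc 16000 * ((es.length + 1) * (n * (n + es.length)))
        ≤ 16000 * ((2 * es.length) * (n * (K * es.length + es.length))) := by
          gcongr
          omega
      _ = 32000 * (K + 1) * (n * es.length ^ 2) := by ring
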